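/- Let $\Gamma$ be a totally ordered abelian group with positive cone $\Gamma^+=\{s\in\Gamma: s\ge 0\}$, let $A$ be a $C^*$-algebra, and let $\alpha:\Gamma^+\to\operatorname{End}A$ be an action ($\alpha_0=\mathrm{id}$, $\alpha_{s+t}=\alpha_s\alpha_t$) by extendible endomorphisms: for each $s$ there is an approximate identity $(a_i)$ of $A$ such that $\alpha_s(a_i)$ converges strictly to a projection in the multiplier algebra $M(A)$. Denote this projection by $\overline{\alpha}_s(1)$. Let $X=\bigsqcup_{s\in\Gamma^+}X_s$ be the product system with fibres $X_s=\{s\}\times\overline{\alpha}_s(1)A$ and operations $$(s,x)\cdot a=(s,xa),\quad a\cdot(s,x)=(s,\alpha_s(a)x),\quad \langle (s,x),(s,y)\rangle_A=x^*y,\quad (s,x)(t,y)=(s+t,\alpha_t(x)y),$$ where $X_0=A$. A Toeplitz representation of $X$ in a $C^*$-algebra $B$ is a map $\psi:X\to B$ such that each $\psi_s=\psi|_{X_s}$ is linear, $\psi_0$ is a $*$-homomorphism of $A$, and $\psi(x\cdot a)=\psi(x)\psi_0(a)$, $\psi(a\cdot x)=\psi_0(a)\psi(x)$, $\psi(x)^*\psi(y)=\psi_0(\langle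 x,y\rangle_A)$ for $x,y\in X_s$, $a\in A$, and $\psi(xy)=\psi(x)\psi(y)$ for $x,y\in X$. Let $\mathcal T_X$ be Fowler's Toeplitz algebra of $X$, that is, the $C^*$-algebra generated by a universal Toeplitz representation of $X$. A covariant partial-isometric representation of $(A,\Gamma^+,\alpha)$ on a Hilbert space $H$ is a pair $(\pi,V)$ of a non-degenerate representation $\pi:A\to B(H)$ and a map $V$ from $\Gamma^+$ to the partial isometries on $H$ with $V_sV_t=V_{s+t}$, such that $\pi(\alpha_s(a))=V_s\pi(a)V_s^*$ and $V_s^*V_s\pi(a)=\pi(a)V_s^*V_s$ for all $s\in\Gamma^+$, $a\in A$. A covariant partial-isometric representation in a $C^*$-algebra $B$ is a pair $(j_A,j_{\Gamma^+})$ of a non-degenerate homomorphism $j_A:A\to B$ and a map $j_{\Gamma^+}$ from $\Gamma^+$ to the partial isometries in $M(B)$ that satisfy the same relations in $M(B)$. For a non-degenerate representation $\rho$ of $B$ on $H$, $\overline\rho$ denotes its extension to $M(B)$. Then there is a covariant partial-isometric representation $(i_A,i_{\Gamma^+})$ of $(A,\Gamma^+,\alpha)$ in $\mathcal T_X$ such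 that $i_A$ is injective and (a) for every covariant partial-isometric representation $(\pi,V)$ of $(A,\Gamma^+,\alpha)$ on a Hilbert space $H$ there is a non-degenerate representation $\pi\times V$ of $\mathcal T_X$ on $H$ such that $(\pi\times V)\circ i_A=\pi$ and $\overline{\pi\times V}\circ i_{\Gamma^+}=V$; (b) $\mathcal T_X$ is generated by $i_A(A)\cup i_{\Gamma^+}(\Gamma^+)$, in the sense that $$\mathcal T_X=\overline{\operatorname{span}}\{i_{\Gamma^+}(s)^*i_A(a)i_{\Gamma^+}(t): a\in A,\ s,t\in\Gamma^+\}.$$ If $(j_A,j_{\Gamma^+})$ is a covariant partial-isometric representation of $(A,\Gamma^+,\alpha)$ in a $C^*$-algebra $B$ with properties (a) and (b) (read with $B$, $j_A$, $j_{\Gamma^+}$ in place of $\mathcal T_X$, $i_A$, $i_{\Gamma^+}$), then there is an isomorphism $\varphi$ of $B$ onto $\mathcal T_X$ with $\varphi\circ j_A=i_A$ and $\overline\varphi\circ j_{\Gamma^+}=i_{\Gamma^+}$, where $\overline\varphi:M(B)\to M(\mathcal T_X)$ is the extension of $\varphi$. -/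

import Mathlib

open scoped MultiplierAlgebra ENNReal

universe u v w z

noncomputable section

namespace PartialIsometric

/-! ### Systems `(A, Γ⁺, α)` -/

/-- The positive cone `Γ⁺ = {s ∈ Γ : 0 ≤ s}` of a totally ordered abelian group `Γ`. -/
abbrev PosCone (Γ : Type v) [AddCommGroup Γ] [LinearOrder Γ] : Type v := {s : Γ // 0 ≤ s}

section Extendible

variable {A : Type u} [NonUnitalCStarAlgebra A]

/-- `α (aᵢ)` converges strictly to the projection `p ∈ M(A)` for some approximate identity `(aᵢ)`
of `A` (given here by the filter of its tails). -/
def IsStrictLimitOfUnit (α : A →⋆ₙₐ[ℂ] A) (p : 𝓜(ℂ, A)) : Prop :=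
  IsStarProjection p ∧ ∃ l : Filter A, l.IsApproximateUnit ∧ ∀ b : A,
    Filter.Tendsto (fun a => α a * b) l (nhds (p.fst b)) ∧
    Filter.Tendsto (fun a => b * α a) l (nhds (p.snd b))

/-- The endomorphism `α` of `A` is extendible. -/
def IsExtendible (α : A →⋆ₙₐ[ℂ] A) : Prop := ∃ p : 𝓜(ℂ, A), IsStrictLimitOfUnit α p

theorem continuous_hom {B : Type w} [NonUnitalCStarAlgebra B] (φ : A →⋆ₙₐ[ℂ] B) : Continuous φ :=
  AddMonoidHomClass.continuous_of_bound φ 1 fun a => by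
    simpa using NonUnitalStarAlgHom.norm_apply_le φ a

theorem IsStrictLimitOfUnit.fst_apply {α : A →⋆ₙₐ[ℂ] A} {p : 𝓜(ℂ, A)}
    (h : IsStrictLimitOfUnit α p) (a : A) : p.fst (α a) = α a := by
  obtain ⟨-, l, hl, hp⟩ := h
  have := hl.neBot
  have hc : Continuous α := continuous_hom α
  have h1 : Filter.Tendsto (fun e => α (e * a)) l (nhds (α a)) :=
    (hc.tendsto a).comp (hl.tendsto_mul_right a)
  exact tendsto_nhds_unique (hp (α a)).1 (by simpa only [map_mul] using h1)

theorem fst_mul (p : 𝓜(ℂ, A)) (a b : A) : p.fst (a * b) = p.fst a * b := by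
  have key : ∀ c : A, c * p.fst (a * b) = c * (p.fst a * b) := fun c => by
    rw [← p.central, ← mul_assoc, p.central, mul_assoc]
  have h := key (star (p.fst (a * b) - p.fst a * b))
  rw [← sub_eq_zero, ← mul_sub] at h
  exact sub_eq_zero.1 ((CStarRing.star_mul_self_eq_zero_iff _).1 h)

end Extendible

/-- An action `α` of `Γ⁺` on the `C*`-algebra `A` by extendible endomorphisms, with `α₀ = id`. -/
structure ExtendibleAction (Γ : Type v) [AddCommGroup Γ] [LinearOrder Γ] [IsOrderedAddMonoid Γ]
    (A : Type u) [NonUnitalCStarAlgebra A] where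
  act : PosCone Γ → A →⋆ₙₐ[ℂ] A
  act_zero : ∀ a, act 0 a = a
  act_add : ∀ s t a, act (s + t) a = act s (act t a)
  extendible : ∀ s, IsExtendible (act s)

section System

variable {Γ : Type v} [AddCommGroup Γ] [LinearOrder Γ] [IsOrderedAddMonoid Γ]
variable {A : Type u} [NonUnitalCStarAlgebra A] (α : ExtendibleAction Γ A)

/-- The projection `ᾱₛ(1) ∈ M(A)`, the strict limit of `αₛ(aᵢ)` along an approximate identity. -/
def barOne (s : PosCone Γ) : 𝓜(ℂ, A) := (α.extendible s).choose

theorem barOne_spec (s : PosCone Γ) : IsStrictLimitOfUnit (α.act s) (barOne α s) :=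
  (α.extendible s).choose_spec

/-! ### The product system `X = ⨆ₛ Xₛ` -/

/-- The fibre `Xₛ = ᾱₛ(1) A`. -/
def Fiber (s : PosCone Γ) : Submodule ℂ A := LinearMap.range (barOne α s).fst.toLinearMap

variable {α} in
theorem mem_fiber {s : PosCone Γ} {x : A} : x ∈ Fiber α s ↔ (barOne α s).fst x = x := by
  constructor
  · rintro ⟨y, rfl⟩
    have h := congrArg (fun m : 𝓜(ℂ, A) => m.fst y) (barOne_spec α s).1.1
    exact h
  · intro h
    exact ⟨x, h⟩

/-- The right action `x · a = x a` of `A` on `Xₛ`. -/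
def rightAct {s : PosCone Γ} (x : Fiber α s) (a : A) : Fiber α s :=
  ⟨x * a, by rw [mem_fiber, fst_mul, mem_fiber.1 x.2]⟩

/-- The left action `a · x = αₛ(a) x` of `A` on `Xₛ`. -/
def leftAct {s : PosCone Γ} (a : A) (x : Fiber α s) : Fiber α s :=
  ⟨α.act s a * x, by rw [mem_fiber, fst_mul, (barOne_spec α s).fst_apply]⟩

/-- The `A`-valued inner product `⟨x, y⟩ = x* y` on `Xₛ`. -/
def ip {s : PosCone Γ} (x y : Fiber α s) : A := star (x : A) * y

theorem barOne_add_fst {s t : PosCone Γ} (x : Fiber α s) :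
    (barOne α (s + t)).fst (α.act t x) = α.act t x := by
  obtain ⟨-, l, hl, hp⟩ := barOne_spec α s
  have := hl.neBot
  have hc : Continuous (α.act t) := continuous_hom (α.act t)
  have h1 : Filter.Tendsto (fun e => α.act t (α.act s e * x)) l (nhds (α.act t x)) := by
    have := (hp x).1
    rw [mem_fiber.1 x.2] at this
    exact (hc.tendsto _).comp this
  have h2 := ((barOne α (s + t)).fst.continuous.tendsto _).comp h1
  refine tendsto_nhds_unique h2 (h1.congr fun e => ?_)
  simp only [Function.comp_apply, map_mul]
  rw [← α.act_add, fst_mul, add_comm t s, (barOne_spec α (s + t)).fst_apply]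

/-- The multiplication `(s, x) (t, y) = (s + t, αₜ(x) y)` of `X`. -/
def mulX {s t : PosCone Γ} (x : Fiber α s) (y : Fiber α t) : Fiber α (s + t) :=
  ⟨α.act t x * y, by rw [mem_fiber, fst_mul, barOne_add_fst]⟩

/-- The identification of `A` with `X₀`. -/
def ofA (a : A) : Fiber α 0 :=
  ⟨a, by
    rw [mem_fiber]
    have h := (barOne_spec α 0).fst_apply a
    rwa [α.act_zero] at h⟩

/-- A Toeplitz representation `ψ` of the product system `X` in a `C*`-algebra `B`: each `ψₛ` is
linear, `ψ₀` is a `*`-homomorphism of `A = X₀`, each `(ψₛ, ψ₀)` is a Toeplitz representation of the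
Hilbert bimodule `Xₛ`, and `ψ` is multiplicative. -/
structure ToeplitzRep (B : Type w) [NonUnitalCStarAlgebra B] where
  map : ∀ s : PosCone Γ, Fiber α s →ₗ[ℂ] B
  hom : A →⋆ₙₐ[ℂ] B
  hom_eq : ∀ a, hom a = map 0 (ofA α a)
  map_rightAct : ∀ s (x : Fiber α s) a, map s (rightAct α x a) = map s x * hom a
  map_ip : ∀ s (x y : Fiber α s), star (map s x) * map s y = hom (ip α x y)
  map_leftAct : ∀ s a (x : Fiber α s), map s (leftAct α a x) = hom a * map s x
  map_mulX : ∀ s t (x : Fiber α s) (y : Fiber α t), map (s + t) (mulX α x y) = map s x * map t y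

variable {α} in
theorem ToeplitzRep.norm_le {B : Type w} [NonUnitalCStarAlgebra B] (ψ : ToeplitzRep α B)
    (s : PosCone Γ) (x : Fiber α s) : ‖ψ.map s x‖ ≤ ‖(x : A)‖ := by
  have h : ‖ψ.map s x‖ * ‖ψ.map s x‖ ≤ ‖(x : A)‖ * ‖(x : A)‖ := by
    rw [← CStarRing.norm_star_mul_self, ψ.map_ip, ← CStarRing.norm_star_mul_self]
    exact NonUnitalStarAlgHom.norm_apply_le ψ.hom _
  exact le_of_sq_le_sq (by simpa only [sq] using h) (norm_nonneg _)

/-! ### The Toeplitz algebra `𝒯_X`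

`𝒯_X` is the `C*`-algebra generated by the direct sum of all Toeplitz representations of `X`. To
have a set of them, the representations are taken in `C*`-algebras whose underlying set is a subset
of one fixed set, which is large enough to hold a copy of every `C*`-algebra that is generated by a
Toeplitz representation of `X` (sequences of `*`-polynomials in elements of `X`). That `𝒯_X` is
universal for the Toeplitz representations in arbitrary `C*`-algebras is proved below. -/

/-- The elements of the disjoint union `X`, and a copy of them that stands for their adjoints. -/
abbrev Letters : Type (max u v) := (Σ s : PosCone Γ, Fiber α s) ⊕ (Σ s : PosCone Γ, Fiber α s)

/-- The fixed underlying set. -/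
def Room : Type (max u v) := ℕ → FreeAlgebra ℂ (Letters α)

/-- The Toeplitz representations of `X` in the `C*`-algebras with underlying set in `Room α`. -/
structure RoomRep : Type (max u v) where
  carrier : Set (Room α)
  [cstar : NonUnitalCStarAlgebra carrier]
  rep : ToeplitzRep α carrier

attribute [instance] RoomRep.cstar

/-- The `ℓ^∞` direct sum of the target algebras. -/
abbrev BigSum : Type (max u v) := lp (fun i : RoomRep α => (i.carrier : Type (max u v))) ∞

/-- The direct sum of the Toeplitz representations, on the element `(s, x)` of `X`. -/
def bigMap (s : PosCone Γ) (x : Fiber α s) : BigSum α :=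
  ⟨fun i => i.rep.map s x, memℓp_infty ⟨‖(x : A)‖, by
    rintro _ ⟨i, rfl⟩
    exact i.rep.norm_le s x⟩⟩

/-- The Toeplitz algebra as a closed `*`-subalgebra. -/
def toeplitzSubalgebra : NonUnitalStarSubalgebra ℂ (BigSum α) :=
  (NonUnitalStarAlgebra.adjoin ℂ
    {b | ∃ (s : PosCone Γ) (x : Fiber α s), b = bigMap α s x}).topologicalClosure

/-- The Toeplitz algebra `𝒯_X`. -/
abbrev ToeplitzAlgebra : Type (max u v) := toeplitzSubalgebra α

instance : NonUnitalCStarAlgebra (ToeplitzAlgebra α) :=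
  NonUnitalStarSubalgebra.nonUnitalCStarAlgebra (toeplitzSubalgebra α)
    (h_closed := NonUnitalStarSubalgebra.isClosed_topologicalClosure _)

theorem bigMap_mem (s : PosCone Γ) (x : Fiber α s) : bigMap α s x ∈ toeplitzSubalgebra α :=
  NonUnitalStarSubalgebra.le_topologicalClosure _
    (NonUnitalStarAlgebra.subset_adjoin ℂ _ ⟨s, x, rfl⟩)

/-- The canonical Toeplitz representation `i_X` of `X` in `𝒯_X`. -/
def iX : ToeplitzRep α (ToeplitzAlgebra α) where
  map s :=
    { toFun := fun x => ⟨bigMap α s x, bigMap_mem α s x⟩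
      map_add' := fun x y => by
        refine Subtype.ext (lp.ext (funext fun i => ?_))
        exact map_add (i.rep.map s) x y
      map_smul' := fun c x => by
        refine Subtype.ext (lp.ext (funext fun i => ?_))
        simp [bigMap] }
  hom :=
    { toFun := fun a => ⟨bigMap α 0 (ofA α a), bigMap_mem α 0 _⟩
      map_zero' := by
        refine Subtype.ext (lp.ext (funext fun i => ?_))
        simp [bigMap, ← ToeplitzRep.hom_eq]
      map_add' := fun a b => by
        refine Subtype.ext (lp.ext (funext fun i => ?_))
        simp only [bigMap, ← ToeplitzRep.hom_eq]
        exact map_add i.rep.hom a b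
      map_smul' := fun c a => by
        refine Subtype.ext (lp.ext (funext fun i => ?_))
        simp [bigMap, ← ToeplitzRep.hom_eq]
      map_mul' := fun a b => by
        refine Subtype.ext (lp.ext (funext fun i => ?_))
        simp [bigMap, ← ToeplitzRep.hom_eq]
      map_star' := fun a => by
        refine Subtype.ext (lp.ext (funext fun i => ?_))
        simp only [bigMap, ← ToeplitzRep.hom_eq]
        exact map_star i.rep.hom a }
  hom_eq a := rfl
  map_rightAct s x a := by
    refine Subtype.ext (lp.ext (funext fun i => ?_))
    simp [bigMap, ← ToeplitzRep.hom_eq, ToeplitzRep.map_rightAct]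
  map_ip s x y := by
    refine Subtype.ext (lp.ext (funext fun i => ?_))
    simp [bigMap, ← ToeplitzRep.hom_eq, ToeplitzRep.map_ip]
  map_leftAct s a x := by
    refine Subtype.ext (lp.ext (funext fun i => ?_))
    simp [bigMap, ← ToeplitzRep.hom_eq, ToeplitzRep.map_leftAct]
  map_mulX s t x y := by
    refine Subtype.ext (lp.ext (funext fun i => ?_))
    simp [bigMap, ToeplitzRep.map_mulX]

theorem exists_transport {S : Type v} {C : Type w} [NonUnitalCStarAlgebra C] (e : S ≃ C) :
    ∃ (_ : NonUnitalCStarAlgebra S), Nonempty (S ≃⋆ₐ[ℂ] C) := by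
  let r : NonUnitalRing S := e.nonUnitalRing
  let m : Module ℂ S := e.module ℂ
  have hadd : ∀ x y, e (x + y) = e x + e y := fun x y => e.apply_symm_apply _
  have hmul : ∀ x y, e (x * y) = e x * e y := fun x y => e.apply_symm_apply _
  have hsmul : ∀ (c : ℂ) x, e (c • x) = c • e x := fun c x => e.apply_symm_apply _
  let st : Star S := ⟨fun x => e.symm (star (e x))⟩
  have hstar : ∀ x, e (star x) = star (e x) := fun x => e.apply_symm_apply _
  let sr : StarRing S :=
    { star_involutive := fun x => e.injective (by simp [hstar])
      star_mul := fun x y => e.injective (by simp [hstar, hmul])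
      star_add := fun x y => e.injective (by simp [hstar, hadd]) }
  let f : S →ₙ+* C :=
    { toFun := e
      map_mul' := hmul
      map_zero' := e.apply_symm_apply _
      map_add' := hadd }
  let nr : NonUnitalNormedRing S := NonUnitalNormedRing.induced S C f e.injective
  have hnorm : ∀ x, ‖x‖ = ‖e x‖ := fun x => rfl
  have hiso : Isometry e := AddMonoidHomClass.isometry_of_norm f fun x => rfl
  have hcs : CompleteSpace S := by
    rw [completeSpace_iff_isComplete_range hiso.isUniformInducing, e.surjective.range_eq]
    exact isComplete_univ
  let c : NonUnitalCStarAlgebra S :=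
    { nr, sr, m, hcs with
      norm_mul_self_le := fun x => by
        rw [hnorm, hnorm, hmul, hstar, CStarRing.norm_star_mul_self]
      norm_smul_le := fun c x => by
        rw [hnorm, hnorm, hsmul, norm_smul]
      smul_assoc := fun c x y => e.injective (by simp [hsmul, hmul, smul_mul_assoc])
      smul_comm := fun c x y => e.injective (by simp [hsmul, hmul, mul_smul_comm])
      star_smul := fun c x => e.injective (by simp [hsmul, hstar]) }
  exact ⟨c, ⟨{ e with
    map_mul' := hmul
    map_add' := hadd
    map_star' := hstar
    map_smul' := hsmul }⟩⟩

variable {α} in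
/-- The composition of a Toeplitz representation with a `*`-homomorphism. -/
def ToeplitzRep.comp {B : Type w} [NonUnitalCStarAlgebra B] {C : Type z}
    [NonUnitalCStarAlgebra C] (φ : B →⋆ₙₐ[ℂ] C) (ψ : ToeplitzRep α B) : ToeplitzRep α C where
  map s :=
    { toFun := fun x => φ (ψ.map s x)
      map_add' := fun x y => by simp
      map_smul' := fun c x => by simp }
  hom := φ.comp ψ.hom
  hom_eq a := by simp [ψ.hom_eq]
  map_rightAct s x a := by simp [ψ.map_rightAct]
  map_ip s x y := by
    change star (φ (ψ.map s x)) * φ (ψ.map s y) = φ (ψ.hom (ip α x y))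
    rw [← ψ.map_ip, map_mul, map_star]
  map_leftAct s a x := by simp [ψ.map_leftAct]
  map_mulX s t x y := by simp [ψ.map_mulX]

variable {α} in
/-- The elements `ψ(x)`. -/
def ToeplitzRep.image {B : Type w} [NonUnitalCStarAlgebra B] (ψ : ToeplitzRep α B) : Set B :=
  {b | ∃ (s : PosCone Γ) (x : Fiber α s), b = ψ.map s x}

variable {α} in
/-- The `C*`-algebra generated by the elements `ψ(x)`. -/
def ToeplitzRep.gen {B : Type w} [NonUnitalCStarAlgebra B] (ψ : ToeplitzRep α B) :
    NonUnitalStarSubalgebra ℂ B := (NonUnitalStarAlgebra.adjoin ℂ ψ.image).topologicalClosure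

variable {α} in
instance ToeplitzRep.genCStar {B : Type w} [NonUnitalCStarAlgebra B] (ψ : ToeplitzRep α B) :
    NonUnitalCStarAlgebra ψ.gen :=
  NonUnitalStarSubalgebra.nonUnitalCStarAlgebra ψ.gen
    (h_closed := NonUnitalStarSubalgebra.isClosed_topologicalClosure _)

variable {α} in
theorem ToeplitzRep.mem_gen {B : Type w} [NonUnitalCStarAlgebra B] (ψ : ToeplitzRep α B)
    (s : PosCone Γ) (x : Fiber α s) : ψ.map s x ∈ ψ.gen :=
  NonUnitalStarSubalgebra.le_topologicalClosure _
    (NonUnitalStarAlgebra.subset_adjoin ℂ _ ⟨s, x, rfl⟩)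

variable {α} in
/-- `ψ` as a Toeplitz representation in the `C*`-algebra that it generates. -/
def ToeplitzRep.corestrict {B : Type w} [NonUnitalCStarAlgebra B] (ψ : ToeplitzRep α B) :
    ToeplitzRep α ψ.gen where
  map s :=
    { toFun := fun x => ⟨ψ.map s x, ψ.mem_gen s x⟩
      map_add' := fun x y => by ext; simp
      map_smul' := fun c x => by ext; simp }
  hom := NonUnitalStarAlgHom.codRestrict ψ.hom ψ.gen
    (fun a => by rw [ψ.hom_eq]; exact ψ.mem_gen _ _)
  hom_eq a := by ext; simp [ψ.hom_eq]
  map_rightAct s x a := by ext; simp [ψ.map_rightAct]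
  map_ip s x y := by ext; simp [← ψ.map_ip]
  map_leftAct s a x := by ext; simp [ψ.map_leftAct]
  map_mulX s t x y := by ext; simp [ψ.map_mulX]

variable {α} in
theorem ToeplitzRep.exists_surjective {B : Type w} [NonUnitalCStarAlgebra B]
    (ψ : ToeplitzRep α B) : ∃ f : Room α → ψ.gen, Function.Surjective f := by
  let L : FreeAlgebra ℂ (Letters α) →ₐ[ℂ] Unitization ℂ B := FreeAlgebra.lift ℂ
    (Sum.elim (fun x => ((ψ.map x.1 x.2 : B) : Unitization ℂ B))
      (fun x => ((star (ψ.map x.1 x.2) : B) : Unitization ℂ B)))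
  have hL : ∀ b ∈ NonUnitalStarAlgebra.adjoin ℂ ψ.image,
      ∃ p, L p = (b : Unitization ℂ B) := by
    intro b hb
    change b ∈ NonUnitalAlgebra.adjoin ℂ (ψ.image ∪ star ψ.image) at hb
    induction hb using NonUnitalAlgebra.adjoin_induction with
    | mem x hx =>
      rcases hx with ⟨s, y, rfl⟩ | ⟨s, y, hy⟩
      · exact ⟨FreeAlgebra.ι ℂ (Sum.inl ⟨s, y⟩), by simp [L]⟩
      · refine ⟨FreeAlgebra.ι ℂ (Sum.inr ⟨s, y⟩), ?_⟩
        simp [L, ← hy]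
    | add x y _ _ hx hy =>
      obtain ⟨p, hp⟩ := hx
      obtain ⟨q, hq⟩ := hy
      exact ⟨p + q, by simp [hp, hq]⟩
    | zero => exact ⟨0, by simp⟩
    | mul x y _ _ hx hy =>
      obtain ⟨p, hp⟩ := hx
      obtain ⟨q, hq⟩ := hy
      exact ⟨p * q, by simp [hp, hq]⟩
    | smul c x _ hx =>
      obtain ⟨p, hp⟩ := hx
      exact ⟨c • p, by simp [hp]⟩
  classical
  have hlim : ∀ c : ψ.gen, ∃ r : Room α, Filter.Tendsto (fun n => L (r n)) Filter.atTop
      (nhds ((c : B) : Unitization ℂ B)) := by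
    rintro ⟨c, hc⟩
    obtain ⟨u, hu, hlim⟩ := mem_closure_iff_seq_limit.1 hc
    choose p hp using fun n => hL (u n) (hu n)
    refine ⟨p, ?_⟩
    simp only [hp]
    exact ((Unitization.isometry_inr (𝕜 := ℂ) (A := B)).continuous.tendsto c).comp hlim
  choose g hg using hlim
  have hginj : Function.Injective g := by
    intro c d hcd
    have h := hg d
    rw [← hcd] at h
    exact Subtype.ext (Unitization.inr_injective (tendsto_nhds_unique (hg c) h))
  exact ⟨Function.invFun g, Function.invFun_surjective hginj⟩

/-- `𝒯_X` is generated by `i_X(X)`: a closed `*`-subalgebra that contains `i_X(X)` is all of it. -/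
theorem toeplitz_generated (S : NonUnitalStarSubalgebra ℂ (ToeplitzAlgebra α))
    (hS : IsClosed (S : Set (ToeplitzAlgebra α))) (h : ∀ s x, (iX α).map s x ∈ S) : S = ⊤ := by
  have hle : toeplitzSubalgebra α ≤
      S.map (NonUnitalStarSubalgebraClass.subtype (toeplitzSubalgebra α)) := by
    refine NonUnitalStarSubalgebra.topologicalClosure_minimal _ ?_ ?_
    · refine NonUnitalStarAlgebra.adjoin_le ?_
      rintro _ ⟨s, x, rfl⟩
      exact ⟨(iX α).map s x, h s x, rfl⟩
    · have hc : IsClosed (toeplitzSubalgebra α : Set (BigSum α)) :=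
        NonUnitalStarSubalgebra.isClosed_topologicalClosure _
      exact hc.isClosedEmbedding_subtypeVal.isClosedMap _ hS
  refine eq_top_iff.2 fun b _ => ?_
  obtain ⟨c, hc, hcb⟩ := hle b.2
  have : c = b := Subtype.ext hcb
  exact this ▸ hc

/-- The universal property of `(𝒯_X, i_X)`: every Toeplitz representation of `X` in a
`C*`-algebra factors uniquely through `i_X`. -/
theorem toeplitz_universal {B : Type w} [NonUnitalCStarAlgebra B] (ψ : ToeplitzRep α B) :
    ∃! φ : ToeplitzAlgebra α →⋆ₙₐ[ℂ] B, ∀ s x, φ ((iX α).map s x) = ψ.map s x := by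
  obtain ⟨f, hf⟩ := ψ.exists_surjective
  have hinj := Function.injective_surjInv hf
  let e : Set.range (Function.surjInv hf) ≃ ψ.gen := (Equiv.ofInjective _ hinj).symm
  obtain ⟨inst, ⟨E⟩⟩ := exists_transport e
  let i₀ : RoomRep α :=
    { carrier := Set.range (Function.surjInv hf)
      cstar := inst
      rep := ψ.corestrict.comp (E.symm : ψ.gen →⋆ₙₐ[ℂ] Set.range (Function.surjInv hf)) }
  let ev : ToeplitzAlgebra α →⋆ₙₐ[ℂ] i₀.carrier :=
    { toFun := fun b => (b : BigSum α) i₀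
      map_smul' := fun c b => rfl
      map_zero' := rfl
      map_add' := fun b c => rfl
      map_mul' := fun b c => rfl
      map_star' := fun b => rfl }
  let φ : ToeplitzAlgebra α →⋆ₙₐ[ℂ] B :=
    ((NonUnitalStarSubalgebraClass.subtype ψ.gen).comp
      (E : Set.range (Function.surjInv hf) →⋆ₙₐ[ℂ] ψ.gen)).comp ev
  have hφ : ∀ s x, φ ((iX α).map s x) = ψ.map s x := fun s x => by
    have h : ev ((iX α).map s x) = E.symm (ψ.corestrict.map s x) := rfl
    change ((E (ev ((iX α).map s x)) : ψ.gen) : B) = _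
    rw [h, StarAlgEquiv.apply_symm_apply]
    rfl
  refine ⟨φ, hφ, fun φ' hφ' => ?_⟩
  have htop := toeplitz_generated α (NonUnitalStarAlgHom.equalizer φ' φ)
    (isClosed_eq (continuous_hom φ') (continuous_hom φ))
    (fun s x => (hφ' s x).trans (hφ s x).symm)
  ext b
  have hb : b ∈ NonUnitalStarAlgHom.equalizer φ' φ := htop ▸ trivial
  exact hb

/-! ### Covariant partial-isometric representations -/

/-- `V` is a partial-isometric representation of `Γ⁺` in the unital `C*`-algebra `C`, and `(π, V)`
satisfies the covariance relations. Here `C` is `B(H)` or a multiplier algebra. -/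
structure IsCovariantPair {C : Type w} [CStarAlgebra C] (π : A →⋆ₙₐ[ℂ] C) (V : PosCone Γ → C) :
    Prop where
  partial_isometry : ∀ s, V s * star (V s) * V s = V s
  map_add : ∀ s t, V s * V t = V (s + t)
  conj : ∀ s a, π (α.act s a) = V s * π a * star (V s)
  comm : ∀ s a, star (V s) * V s * π a = π a * (star (V s) * V s)

/-- Non-degeneracy of a representation on a Hilbert space: the vectors `π(b)h` span a dense
subspace. -/
def IsNondegenerate {B : Type w} [NonUnitalCStarAlgebra B] {H : Type z} [NormedAddCommGroup H]
    [InnerProductSpace ℂ H] [CompleteSpace H] (π : B →⋆ₙₐ[ℂ] (H →L[ℂ] H)) : Prop :=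
  (Submodule.span ℂ {k : H | ∃ (b : B) (h : H), k = π b h}).topologicalClosure = ⊤

/-- `(π, V)` is a covariant partial-isometric representation of `(A, Γ⁺, α)` on `H`. -/
def IsCovariantRep {H : Type w} [NormedAddCommGroup H] [InnerProductSpace ℂ H] [CompleteSpace H]
    (π : A →⋆ₙₐ[ℂ] (H →L[ℂ] H)) (V : PosCone Γ → (H →L[ℂ] H)) : Prop :=
  IsNondegenerate π ∧ IsCovariantPair α π V

/-- `(j_A, j_Γ)` is a covariant partial-isometric representation of `(A, Γ⁺, α)` in the
`C*`-algebra `B`: `j_A` is a non-degenerate homomorphism into `B`, and the partial isometries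
`j_Γ(s)` lie in `M(B)`. -/
def IsCovariantIn {B : Type w} [NonUnitalCStarAlgebra B] (jA : A →⋆ₙₐ[ℂ] B)
    (jΓ : PosCone Γ → 𝓜(ℂ, B)) : Prop :=
  (Submodule.span ℂ {c : B | ∃ (a : A) (b : B), c = jA a * b}).topologicalClosure = ⊤ ∧
    IsCovariantPair α ((DoubleCentralizer.coeHom (𝕜 := ℂ) (A := B)).comp jA) jΓ

/-- Every covariant partial-isometric representation `(π, V)` on a Hilbert space `H` comes from a
non-degenerate representation `ρ = π × V` of `B` on `H`, in that `ρ ∘ j_A = π` and `ρ̄ ∘ j_Γ = V`,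
where `ρ̄` is the extension of `ρ` to `M(B)` (it is unique, since `ρ` is non-degenerate). -/
def LiftsCovariantReps {B : Type z} [NonUnitalCStarAlgebra B] (jA : A →⋆ₙₐ[ℂ] B)
    (jΓ : PosCone Γ → 𝓜(ℂ, B)) : Prop :=
  ∀ (H : Type w) [NormedAddCommGroup H] [InnerProductSpace ℂ H] [CompleteSpace H]
    (π : A →⋆ₙₐ[ℂ] (H →L[ℂ] H)) (V : PosCone Γ → (H →L[ℂ] H)), IsCovariantRep α π V →
    ∃ ρ : B →⋆ₙₐ[ℂ] (H →L[ℂ] H), IsNondegenerate ρ ∧ (∀ a, ρ (jA a) = π a) ∧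
      ∃ ρbar : 𝓜(ℂ, B) →⋆ₐ[ℂ] (H →L[ℂ] H), (∀ b : B, ρbar (b : 𝓜(ℂ, B)) = ρ b) ∧
        ∀ s, ρbar (jΓ s) = V s

/-- `B` is the closed linear span of the elements `j_Γ(s)* j_A(a) j_Γ(t)`, as a subset of `M(B)`. -/
def IsClosedSpan {B : Type w} [NonUnitalCStarAlgebra B] (jA : A →⋆ₙₐ[ℂ] B)
    (jΓ : PosCone Γ → 𝓜(ℂ, B)) : Prop :=
  Set.range (fun b : B => (b : 𝓜(ℂ, B))) = closure (Submodule.span ℂ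
    {m : 𝓜(ℂ, B) | ∃ (s t : PosCone Γ) (a : A),
      m = star (jΓ s) * (jA a : 𝓜(ℂ, B)) * jΓ t} : Set 𝓜(ℂ, B))

end System
end PartialIsometric
end

/-! Toeplitz representations ψ of X and covariant pairs (π, V) determine each other through π = ψ₀
and ψₛ(x) = Vₛ* π(x).

From a pair to ψ: covariance gives π(a)Vₛ* = Vₛ*π(αₛ(a)), which yields the left action and the
multiplicativity, and VₛVₛ* fixes π(x) for x in ᾱₛ(1)A, which yields the inner product formula
(`IsCovariantPair.toeplitzRep`).

From ψ to a pair: let ψ generate B, and extend ψₛ to A by a ↦ ψₛ(ᾱₛ(1)a). Along a bounded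
approximate identity (e) of A the elements ψₛ(ᾱₛ(1)e) converge strictly to a multiplier Wₛ with
Wₛψ₀(a) = ψₛ(ᾱₛ(1)a), and Vₛ = Wₛ* is the required partial isometry
(`ToeplitzRep.exists_multiplier`, `ToeplitzRep.exists_isCovariantIn`). The order on Γ is total, so
for ψₛ(·)*ψₜ(·) the larger index can always be split off the smaller one.

For ψ = i_X this produces i_A and i_Γ. Property (a) is the universal property of 𝒯_X applied to x ↦
Vₛ*π(x). Property (b) holds because VᵣVᵣ* acts on π(A) as ᾱᵣ(1), so that the elements Vₛ*π(a)Vₜ are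
closed under products (`IsCovariantPair.exists_mul_eq`). The map i_A is injective because the
backward shifts on ℓ²(Γ⁺, K) form a covariant pair whose representation of A is faithful
(`isCovariantPair_shift`).

For uniqueness, represent 𝒯_X faithfully by σ and restrict to a covariant pair. Property (a) of B
gives a representation ρ of B, property (b) places its range in σ(𝒯_X), and ρ thus factors through a
homomorphism B → 𝒯_X. Its inverse comes from the universal property of 𝒯_X. -/

noncomputable section

namespace PartialIsometric

open Filter Topology

/-! ### Strong limits of bounded families of operators. -/

section StrongLimits

variable {ι : Type*} {E : Type*} {F : Type*} [NormedAddCommGroup E] [NormedSpace ℂ E]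
  [NormedAddCommGroup F] [NormedSpace ℂ F]

/-- The vectors on which a family of operators converges. -/
def convergenceDomain (T : ι → E →L[ℂ] F) (l : Filter ι) : Submodule ℂ E where
  carrier := {v | ∃ y, Tendsto (fun i => T i v) l (𝓝 y)}
  add_mem' := by
    rintro v v' ⟨y, hy⟩ ⟨y', hy'⟩
    exact ⟨y + y', by simpa using hy.add hy'⟩
  zero_mem' := ⟨0, by simpa using tendsto_const_nhds⟩
  smul_mem' := by
    rintro c v ⟨y, hy⟩
    exact ⟨c • y, by simpa using hy.const_smul c⟩

/-- An ε/3 argument with the uniform bound, followed by completeness of `F`. Convergence therefore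
needs checking only on vectors that span a dense subspace. -/
theorem isClosed_convergenceDomain [CompleteSpace F] (T : ι → E →L[ℂ] F) (l : Filter ι) [NeBot l]
    (C : ℝ) (hC : ∀ᶠ i in l, ‖T i‖ ≤ C) :
    IsClosed (convergenceDomain T l : Set E) := by
  refine isClosed_of_closure_subset fun v hv => ?_
  have hC0 : 0 ≤ C := by
    obtain ⟨i, hi⟩ := hC.exists
    exact (norm_nonneg _).trans hi
  change ∃ y, Tendsto (fun i => T i v) l (𝓝 y)
  have hcau : Cauchy (map (fun i => T i v) l) := by
    rw [Metric.cauchy_iff]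
    refine ⟨inferInstance, fun ε hε => ?_⟩
    obtain ⟨v', ⟨y, hy⟩, hvv'⟩ := Metric.mem_closure_iff.1 hv (ε / (4 * (C + 1))) (by positivity)
    refine ⟨Metric.ball y (ε / 2), ?_, fun a ha b hb => ?_⟩
    · rw [mem_map]
      filter_upwards [hC, Metric.tendsto_nhds.1 hy (ε / 4) (by positivity)] with i hi hi'
      have h1 : dist (T i v) (T i v') ≤ (C + 1) * dist v v' := by
        rw [dist_eq_norm, dist_eq_norm, ← map_sub]
        exact (T i).le_of_opNorm_le (hi.trans (by linarith)) _
      have h2 : (C + 1) * dist v v' < ε / 4 := by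
        calc _ < (C + 1) * (ε / (4 * (C + 1))) := by gcongr
          _ = ε / 4 := by field_simp
      have := dist_triangle (T i v) (T i v') y
      simp only [Set.mem_preimage, Metric.mem_ball]
      linarith
    · have := dist_triangle_right a b y
      rw [Metric.mem_ball] at ha hb
      linarith
  exact CompleteSpace.complete hcau

theorem exists_strongLimit (T : ι → E →L[ℂ] F) (l : Filter ι) [NeBot l]
    (C : ℝ) (hC : ∀ᶠ i in l, ‖T i‖ ≤ C) (h : convergenceDomain T l = ⊤) :
    ∃ T' : E →L[ℂ] F, ∀ v, Tendsto (fun i => T i v) l (𝓝 (T' v)) := by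
  have h' : ∀ v, ∃ y, Tendsto (fun i => T i v) l (𝓝 y) := fun v =>
    (h ▸ Submodule.mem_top : v ∈ convergenceDomain T l)
  choose f hf using h'
  refine ⟨LinearMap.mkContinuous
    { toFun := f
      map_add' := fun v v' => tendsto_nhds_unique (hf _) (by simpa using (hf v).add (hf v'))
      map_smul' := fun c v => tendsto_nhds_unique (hf _) (by simpa using (hf v).const_smul c) } C
    fun v => ?_, hf⟩
  refine le_of_tendsto (hf v).norm ?_
  filter_upwards [hC] with i hi using (T i).le_of_opNorm_le hi v

/-- The same ε/3 argument with the limit operator prescribed, so that completeness is not needed. -/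
theorem isClosed_setOf_tendsto (T : ι → E →L[ℂ] F) (T' : E →L[ℂ] F) (l : Filter ι) (C : ℝ)
    (hC : ∀ᶠ i in l, ‖T i‖ ≤ C) : IsClosed {v | Tendsto (fun i => T i v) l (𝓝 (T' v))} := by
  refine isClosed_of_closure_subset fun v hv => ?_
  refine Metric.tendsto_nhds.2 fun ε hε => ?_
  set D := |C| + ‖T'‖ + 1 with hD
  have hDpos : 0 < D := by positivity
  obtain ⟨v', hy, hvv'⟩ := Metric.mem_closure_iff.1 hv (ε / (4 * D)) (by positivity)
  have h2 : D * dist v v' < ε / 4 := by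
    calc _ < D * (ε / (4 * D)) := by gcongr
      _ = ε / 4 := by field_simp
  filter_upwards [hC, Metric.tendsto_nhds.1 hy (ε / 4) (by positivity)] with i hi hi'
  have h1 : dist (T i v) (T i v') ≤ D * dist v v' := by
    rw [dist_eq_norm, dist_eq_norm, ← map_sub]
    refine (T i).le_of_opNorm_le (hi.trans ?_) _
    have := le_abs_self C
    have := norm_nonneg T'
    linarith
  have h3 : dist (T' v') (T' v) ≤ D * dist v v' := by
    rw [dist_comm v, dist_eq_norm, dist_eq_norm, ← map_sub]
    refine T'.le_of_opNorm_le ?_ _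
    have := abs_nonneg C
    linarith
  have := dist_triangle4 (T i v) (T i v') (T' v') (T' v)
  linarith

end StrongLimits

/-! ### Multiplier algebras and strict limits. -/

section CStar

variable {B : Type w} [NonUnitalCStarAlgebra B]

theorem exists_bounded_approximateUnit (B : Type w) [NonUnitalCStarAlgebra B] :
    ∃ l : Filter B, l.IsApproximateUnit ∧ ∀ᶠ e in l, ‖e‖ ≤ 1 := by
  let _ := CStarAlgebra.spectralOrder B
  let _ := CStarAlgebra.spectralOrderedRing B
  have h := CStarAlgebra.increasingApproximateUnit B
  exact ⟨_, h.toIsApproximateUnit, h.eventually_norm⟩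

theorem coe_injective : Function.Injective (fun b : B => (b : 𝓜(ℂ, B))) := fun b c h => by
  have h' : ∀ x, b * x = c * x := fun x => congrArg (fun m : 𝓜(ℂ, B) => m.fst x) h
  have := h' (star (b - c))
  rw [← sub_eq_zero, ← sub_mul] at this
  exact sub_eq_zero.1 ((CStarRing.mul_star_self_eq_zero_iff _).1 this)

theorem isometry_coe : Isometry (fun b : B => (b : 𝓜(ℂ, B))) :=
  NonUnitalStarAlgHom.isometry (DoubleCentralizer.coeHom (𝕜 := ℂ) (A := B)) coe_injective

theorem coe_mul (a b : B) : ((a * b : B) : 𝓜(ℂ, B)) = a * b :=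
  map_mul (DoubleCentralizer.coeHom (𝕜 := ℂ) (A := B)) a b

theorem coe_star (a : B) : ((star a : B) : 𝓜(ℂ, B)) = star (a : 𝓜(ℂ, B)) :=
  map_star (DoubleCentralizer.coeHom (𝕜 := ℂ) (A := B)) a

theorem snd_mul (p : 𝓜(ℂ, B)) (a b : B) : p.snd (a * b) = a * p.snd b := by
  have h := fst_mul (star p) (star b) (star a)
  rw [← star_mul, DoubleCentralizer.star_fst, DoubleCentralizer.star_fst, star_star, star_star]
    at h
  simpa using congrArg star h

theorem mul_coe (m : 𝓜(ℂ, B)) (b : B) : m * (b : 𝓜(ℂ, B)) = ((m.fst b : B) : 𝓜(ℂ, B)) := by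
  refine DoubleCentralizer.ext _ _ _ _ (Prod.ext ?_ ?_)
  · ext x
    exact fst_mul m b x
  · ext x
    exact m.central x b

theorem coe_mul_multiplier (m : 𝓜(ℂ, B)) (b : B) :
    (b : 𝓜(ℂ, B)) * m = ((m.snd b : B) : 𝓜(ℂ, B)) := by
  refine DoubleCentralizer.ext _ _ _ _ (Prod.ext ?_ ?_)
  · ext x
    exact (m.central b x).symm
  · ext x
    exact snd_mul m x b

/-- Centrality (x m) y = x (m y) determines the right component from the left one, since only 0
annihilates all of `B`. -/
theorem multiplier_ext {m m' : 𝓜(ℂ, B)} (h : ∀ b, m.fst b = m'.fst b) : m = m' := by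
  refine DoubleCentralizer.ext _ _ _ _ (Prod.ext (by ext x; exact h x) ?_)
  ext x
  have key : ∀ y, (m.snd x - m'.snd x) * y = 0 := fun y => by
    rw [sub_mul, m.central, m'.central, h, sub_self]
  exact sub_eq_zero.1 ((CStarRing.mul_star_self_eq_zero_iff _).1 (key _))

/-- A bounded family whose products with the elements of `B` converge has a strict limit. -/
theorem exists_strictLimit {ι : Type*} (x : ι → B) (l : Filter ι) [NeBot l] (C : ℝ)
    (hC : ∀ᶠ i in l, ‖x i‖ ≤ C)
    (h₁ : convergenceDomain (fun i => ContinuousLinearMap.mul ℂ B (x i)) l = ⊤)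
    (h₂ : convergenceDomain (fun i => ContinuousLinearMap.mul ℂ B (star (x i))) l = ⊤) :
    ∃ m : 𝓜(ℂ, B), ∀ c, Tendsto (fun i => x i * c) l (𝓝 (m.fst c)) ∧
      Tendsto (fun i => c * x i) l (𝓝 (m.snd c)) := by
  obtain ⟨L, hL⟩ := exists_strongLimit _ l C
    (hC.mono fun i hi => (ContinuousLinearMap.opNorm_mul_apply_le ℂ B (x i)).trans hi) h₁
  obtain ⟨R, hR⟩ := exists_strongLimit _ l C
    (hC.mono fun i hi => (ContinuousLinearMap.opNorm_mul_apply_le ℂ B (star (x i))).trans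
      ((norm_star (x i)).trans_le hi)) h₂
  simp only [ContinuousLinearMap.mul_apply'] at hL hR
  -- Limits of right multiplications are the adjoints of limits of left multiplications by the
  -- adjoints.
  have hR' : ∀ c, Tendsto (fun i => c * x i) l (𝓝 (star (R (star c)))) := fun c => by
    have := (continuous_star.tendsto _).comp (hR (star c))
    simpa [Function.comp_def] using this
  refine ⟨⟨⟨L, (((starₗᵢ ℂ : B ≃ₗᵢ⋆[ℂ] B) : B →L⋆[ℂ] B).comp R).comp
    ((starₗᵢ ℂ : B ≃ₗᵢ⋆[ℂ] B) : B →L⋆[ℂ] B)⟩, fun a b => ?_⟩, fun c => ⟨hL c, hR' c⟩⟩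
  refine tendsto_nhds_unique ((hR' a).mul_const b) ?_
  simpa [mul_assoc] using (hL b).const_mul a

/-- The isomorphism of multiplier algebras induced by an isomorphism of `C*`-algebras. -/
theorem exists_multiplierMap {C : Type z} [NonUnitalCStarAlgebra C] (φ : B ≃⋆ₐ[ℂ] C) :
    ∃ φbar : 𝓜(ℂ, B) →⋆ₐ[ℂ] 𝓜(ℂ, C), (∀ b : B, φbar (b : 𝓜(ℂ, B)) = ((φ b : C) : 𝓜(ℂ, C))) ∧
      ∀ m c, (φbar m).fst (φ c) = φ (m.fst c) := by
  let f : B →L[ℂ] C := ⟨(φ : B →ₗ[ℂ] C), continuous_hom (φ : B →⋆ₙₐ[ℂ] C)⟩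
  let g : C →L[ℂ] B := ⟨(φ.symm : C →ₗ[ℂ] B), continuous_hom (φ.symm : C →⋆ₙₐ[ℂ] B)⟩
  have hfg : ∀ c, φ (φ.symm c) = c := φ.apply_symm_apply
  have hgf : ∀ c, φ.symm (φ c) = c := φ.symm_apply_apply
  let Φ : 𝓜(ℂ, B) → 𝓜(ℂ, C) := fun m =>
    ⟨⟨f.comp (m.fst.comp g), f.comp (m.snd.comp g)⟩, fun x y => by
      change φ (m.snd (φ.symm x)) * y = x * φ (m.fst (φ.symm y))
      rw [← hfg y, hgf, ← map_mul, m.central, map_mul, hfg]⟩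
  have hΦ : ∀ m c, (Φ m).fst c = φ (m.fst (φ.symm c)) := fun m c => rfl
  have hΦ' : ∀ m c, (Φ m).snd c = φ (m.snd (φ.symm c)) := fun m c => rfl
  have hc : ∀ b : B, Φ (b : 𝓜(ℂ, B)) = ((φ b : C) : 𝓜(ℂ, C)) := fun b =>
    multiplier_ext fun c => by
      rw [hΦ]
      change φ (b * φ.symm c) = φ b * c
      rw [map_mul, hfg]
  refine ⟨{ toFun := Φ
            map_one' := multiplier_ext fun c => hfg c
            map_zero' := multiplier_ext fun c => map_zero φ
            map_add' := fun m m' => multiplier_ext fun c => map_add φ _ _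
            map_mul' := fun m m' => multiplier_ext fun c => by
              change φ (m.fst (m'.fst (φ.symm c))) = φ (m.fst (φ.symm (φ (m'.fst (φ.symm c)))))
              rw [hgf]
            commutes' := fun k => multiplier_ext fun c => by
              rw [hΦ, DoubleCentralizer.algebraMap_fst, DoubleCentralizer.algebraMap_fst,
                Algebra.algebraMap_eq_smul_one, Algebra.algebraMap_eq_smul_one]
              change φ (k • φ.symm c) = k • c
              rw [map_smul, hfg]
            map_star' := fun m => multiplier_ext fun c => by
              rw [hΦ, DoubleCentralizer.star_fst, DoubleCentralizer.star_fst, hΦ', map_star φ.symm,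
                ← map_star φ] }, hc, fun m c => ?_⟩
  change φ (m.fst (φ.symm (φ c))) = _
  rw [hgf]

end CStar

/-! ### Non-degenerate representations and their extension to multipliers. -/

section Representations

variable {B : Type w} [NonUnitalCStarAlgebra B] {H : Type z} [NormedAddCommGroup H]
  [InnerProductSpace ℂ H] [CompleteSpace H]

theorem IsNondegenerate.eq_top {ρ : B →⋆ₙₐ[ℂ] (H →L[ℂ] H)} (hρ : IsNondegenerate ρ)
    {K : Submodule ℂ H} (hK : IsClosed (K : Set H)) (h : ∀ b x, ρ b x ∈ K) : K = ⊤ := by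
  refine top_le_iff.1 (hρ ▸ Submodule.topologicalClosure_minimal _ (Submodule.span_le.2 ?_) hK)
  rintro _ ⟨b, x, rfl⟩
  exact h b x

theorem IsNondegenerate.ext {ρ : B →⋆ₙₐ[ℂ] (H →L[ℂ] H)} (hρ : IsNondegenerate ρ)
    {X Y : H →L[ℂ] H} (h : ∀ b, X * ρ b = Y * ρ b) : X = Y := by
  have htop : LinearMap.eqLocus (X : H →ₗ[ℂ] H) (Y : H →ₗ[ℂ] H) = ⊤ :=
    hρ.eq_top (isClosed_eq X.continuous Y.continuous)
      fun b x => congrArg (fun Z : H →L[ℂ] H => Z x) (h b)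
  ext x
  have hx : x ∈ LinearMap.eqLocus (X : H →ₗ[ℂ] H) (Y : H →ₗ[ℂ] H) := htop ▸ trivial
  exact hx

theorem IsNondegenerate.of_comp {A : Type u} [NonUnitalCStarAlgebra A] {f : A →⋆ₙₐ[ℂ] B}
    {ρ : B →⋆ₙₐ[ℂ] (H →L[ℂ] H)} (h : IsNondegenerate (ρ.comp f)) : IsNondegenerate ρ := by
  refine h.eq_top (Submodule.isClosed_topologicalClosure _) fun a x => ?_
  exact Submodule.le_topologicalClosure _ (Submodule.subset_span ⟨f a, x, rfl⟩)

theorem IsNondegenerate.comp {A : Type u} [NonUnitalCStarAlgebra A] {f : A →⋆ₙₐ[ℂ] B}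
    {ρ : B →⋆ₙₐ[ℂ] (H →L[ℂ] H)} (h : IsNondegenerate ρ)
    (hf : (Submodule.span ℂ {c : B | ∃ (a : A) (b : B), c = f a * b}).topologicalClosure = ⊤) :
    IsNondegenerate (ρ.comp f) := by
  refine h.eq_top (Submodule.isClosed_topologicalClosure _) fun b x => ?_
  set K := (Submodule.span ℂ {k : H | ∃ (a : A) (y : H), k = ρ.comp f a y}).topologicalClosure
  let e : B →ₗ[ℂ] H :=
    { toFun := fun b => ρ b x
      map_add' := fun b c => by simp
      map_smul' := fun c b => by simp }
  have he : Continuous e := (continuous_hom ρ).clm_apply continuous_const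
  have hle : (Submodule.span ℂ {c : B | ∃ (a : A) (b : B), c = f a * b}).topologicalClosure ≤
      K.comap e := by
    refine Submodule.topologicalClosure_minimal _ (Submodule.span_le.2 ?_)
      ((Submodule.isClosed_topologicalClosure _).preimage he)
    rintro _ ⟨a, c, rfl⟩
    refine Submodule.le_topologicalClosure _ (Submodule.subset_span ⟨a, ρ c x, ?_⟩)
    simp [e]
  exact hle (hf ▸ Submodule.mem_top : b ∈ _)

/-- The extension of a non-degenerate representation to the multiplier algebra. -/
theorem IsNondegenerate.exists_extension {ρ : B →⋆ₙₐ[ℂ] (H →L[ℂ] H)} (hρ : IsNondegenerate ρ) :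
    ∃ ρbar : 𝓜(ℂ, B) →⋆ₐ[ℂ] (H →L[ℂ] H), ∀ b : B, ρbar (b : 𝓜(ℂ, B)) = ρ b := by
  obtain ⟨l, hl, hb⟩ := exists_bounded_approximateUnit B
  have := hl.neBot
  -- The extension sends m to the strong limit of ρ(m e). On ρ(b)x this is the limit of ρ(m(eb))x,
  -- which is ρ(m b)x, and such vectors span a dense subspace.
  have hlim : ∀ (m : 𝓜(ℂ, B)) (b : B) (x : H),
      Tendsto (fun e => ρ (m.fst e) (ρ b x)) l (𝓝 (ρ (m.fst b) x)) := fun m b x => by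
    have h1 : Tendsto (fun e => ρ (m.fst (e * b)) x) l (𝓝 (ρ (m.fst b) x)) :=
      (((continuous_hom ρ).clm_apply continuous_const).tendsto (m.fst b)).comp
        ((m.fst.continuous.tendsto b).comp (hl.tendsto_mul_right b))
    simpa [fst_mul] using h1
  have hex : ∀ m : 𝓜(ℂ, B), ∃ X : H →L[ℂ] H, ∀ b, X * ρ b = ρ (m.fst b) := fun m => by
    obtain ⟨X, hX⟩ := exists_strongLimit (fun e => ρ (m.fst e)) l ‖m.fst‖
      (hb.mono fun e he => (NonUnitalStarAlgHom.norm_apply_le ρ _).trans <|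
        (m.fst.le_opNorm e).trans (mul_le_of_le_one_right (norm_nonneg _) he))
      (hρ.eq_top (isClosed_convergenceDomain _ _ ‖m.fst‖
        (hb.mono fun e he => (NonUnitalStarAlgHom.norm_apply_le ρ _).trans <|
        (m.fst.le_opNorm e).trans (mul_le_of_le_one_right (norm_nonneg _) he)))
        fun b x => ⟨_, hlim m b x⟩)
    exact ⟨X, fun b => ContinuousLinearMap.ext fun x => tendsto_nhds_unique (hX _) (hlim m b x)⟩
  choose X hX using hex
  have hext : ∀ (m : 𝓜(ℂ, B)) (Y : H →L[ℂ] H), (∀ b, ρ (m.fst b) = Y * ρ b) → X m = Y :=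
    fun m Y h => hρ.ext fun b => (hX m b).trans (h b)
  refine ⟨{ toFun := X
            map_one' := hext _ _ fun b => (one_mul _).symm
            map_zero' := hext _ _ fun b => by
              rw [zero_mul]
              exact map_zero ρ
            map_add' := fun m m' => hext _ _ fun b => by
              rw [add_mul, hX, hX, ← map_add]
              rfl
            map_mul' := fun m m' => hext _ _ fun b => by
              rw [mul_assoc, hX, hX]
              rfl
            commutes' := fun k => hext _ _ fun b => by
              rw [DoubleCentralizer.algebraMap_fst, Algebra.algebraMap_eq_smul_one,
                Algebra.algebraMap_eq_smul_one, smul_mul_assoc, one_mul, ← map_smul]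
              rfl
            map_star' := fun m => hext _ _ fun b => ?_ }, fun c => hext _ _ fun b => ?_⟩
  -- Centrality gives the identity only after multiplication by ρ(c) on the left. Taking adjoints
  -- moves this factor to the right, where non-degeneracy removes it.
  · have h : ∀ c, ρ c * ρ ((star m).fst b) = ρ c * (star (X m) * ρ b) := fun c => by
      rw [← mul_assoc, ← map_mul, ← (star m).central, map_mul, DoubleCentralizer.star_snd,
        map_star, ← hX, star_mul, ← map_star, star_star]
    have h2 : star (ρ ((star m).fst b)) = star (star (X m) * ρ b) := hρ.ext fun c => by
      have := congrArg star (h (star c))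
      rwa [star_mul, star_mul, ← map_star ρ (star c), star_star] at this
    exact star_injective h2
  · change ρ (c * b) = _
    exact map_mul ρ c b

end Representations

/-! ### Direct sums of representations. -/

section DirectSum

variable {B : Type w} [NonUnitalCStarAlgebra B] {ι : Type*} {K : ι → Type*}
  [∀ i, NormedAddCommGroup (K i)] [∀ i, InnerProductSpace ℂ (K i)] [∀ i, CompleteSpace (K i)]

/-- The direct sum of a family of representations. -/
def directSumRep (π : ∀ i, B →⋆ₙₐ[ℂ] (K i →L[ℂ] K i)) : B →⋆ₙₐ[ℂ] (lp K 2 →L[ℂ] lp K 2) where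
  toFun b := lp.mapCLM 2 (fun i => π i b) (norm_nonneg b)
    fun i => NonUnitalStarAlgHom.norm_apply_le (π i) b
  map_zero' := by ext; simp
  map_add' b c := by ext; simp
  map_smul' k b := by ext; simp
  map_mul' b c := by ext; simp
  map_star' b := by
    rw [ContinuousLinearMap.star_eq_adjoint, ContinuousLinearMap.eq_adjoint_iff]
    intro x y
    rw [lp.inner_eq_tsum, lp.inner_eq_tsum]
    refine tsum_congr fun i => ?_
    simp [map_star, ContinuousLinearMap.star_eq_adjoint, ContinuousLinearMap.adjoint_inner_left]

@[simp]
theorem directSumRep_apply (π : ∀ i, B →⋆ₙₐ[ℂ] (K i →L[ℂ] K i)) (b : B) (x : lp K 2) (i : ι) :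
    directSumRep π b x i = π i b (x i) := by
  simp [directSumRep]

theorem directSumRep_single [DecidableEq ι] (π : ∀ i, B →⋆ₙₐ[ℂ] (K i →L[ℂ] K i)) (b : B) (i : ι)
    (x : K i) : directSumRep π b (lp.single 2 i x) = lp.single 2 i (π i b x) := by
  ext j
  rw [directSumRep_apply]
  rcases eq_or_ne j i with rfl | h
  · simp
  · simp [h]

theorem directSumRep_injective (π : ∀ i, B →⋆ₙₐ[ℂ] (K i →L[ℂ] K i))
    (h : ∀ b ≠ 0, ∃ i, π i b ≠ 0) : Function.Injective (directSumRep π) := by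
  classical
  rw [injective_iff_map_eq_zero]
  intro b hb
  by_contra hne
  obtain ⟨i, hi⟩ := h b hne
  refine hi (ContinuousLinearMap.ext fun x => ?_)
  have := directSumRep_apply π b (lp.single 2 i x) i
  rw [hb] at this
  simpa using this.symm

theorem directSumRep_nondegenerate {π : ∀ i, B →⋆ₙₐ[ℂ] (K i →L[ℂ] K i)}
    (h : ∀ i, IsNondegenerate (π i)) : IsNondegenerate (directSumRep π) := by
  classical
  set S := (Submodule.span ℂ
    {k : lp K 2 | ∃ (b : B) (x : lp K 2), k = directSumRep π b x}).topologicalClosure with hS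
  have hcl : IsClosed (S : Set (lp K 2)) := Submodule.isClosed_topologicalClosure _
  have hs : ∀ i (x : K i), lp.single 2 i x ∈ S := fun i x => by
    have htop : S.comap (lp.singleContinuousLinearMap ℂ K 2 i : K i →ₗ[ℂ] lp K 2) = ⊤ := by
      refine (h i).eq_top
        (hcl.preimage (lp.singleContinuousLinearMap ℂ K 2 i).continuous) fun b y => ?_
      refine Submodule.le_topologicalClosure _ (Submodule.subset_span ⟨b, lp.single 2 i y, ?_⟩)
      exact (directSumRep_single π b i y).symm
    exact (htop ▸ Submodule.mem_top :
      x ∈ S.comap (lp.singleContinuousLinearMap ℂ K 2 i : K i →ₗ[ℂ] lp K 2))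
  refine eq_top_iff.2 fun x _ => ?_
  exact hcl.mem_of_tendsto (lp.hasSum_single (by simp) x)
    (Eventually.of_forall fun s => S.sum_mem fun i _ => hs i _)

end DirectSum

/-! ### Faithful non-degenerate representations. -/

section GelfandNaimark

open scoped ComplexOrder

/-- Hahn–Banach separates -b*b from the closed positive cone by a real functional f. The complex
extension of x ↦ f(x + x*) equals 2f on self-adjoint elements, so it is positive and nonzero at b*b.
-/
theorem exists_positive_functional {B : Type w} [NonUnitalCStarAlgebra B] [PartialOrder B]
    [StarOrderedRing B] {b : B} (hb : b ≠ 0) : ∃ f : B →ₚ[ℂ] ℂ, f (star b * b) ≠ 0 := by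
  obtain ⟨f, hf, hfb⟩ := (ProperCone.positive ℝ B).hyperplane_separation_point
    (x₀ := -(star b * b)) (fun h => by
      have h1 : 0 ≤ -(star b * b) := h
      have h2 : star b * b = 0 := le_antisymm (neg_nonneg.1 h1) (star_mul_self_nonneg b)
      exact hb ((CStarRing.star_mul_self_eq_zero_iff _).1 h2))
  let F : Module.Dual ℝ B := (f : B →ₗ[ℝ] ℝ) ∘ₗ
    (LinearMap.id + ((starL' ℝ : B ≃L[ℝ] B) : B →L[ℝ] B).toLinearMap)
  have hF : ∀ x, F x = f (x + star x) := fun x => rfl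
  let g : B →ₗ[ℂ] ℂ := F.extendRCLike
  have hg : ∀ x, IsSelfAdjoint x → g x = ((2 * f x : ℝ) : ℂ) := fun x hx => by
    have h0 : Complex.I • x + star (Complex.I • x) = 0 := by simp [hx.star_eq]
    have h1 : g x = (F x : ℂ) - Complex.I * (F (Complex.I • x) : ℂ) :=
      Module.Dual.extendRCLike_apply F x
    rw [h1, hF, hF, h0, hx.star_eq]
    simp [two_mul]
  refine ⟨PositiveLinearMap.mk₀ g fun x hx => ?_, ?_⟩
  · rw [hg x (.of_nonneg hx)]
    have : 0 ≤ f x := hf x hx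
    exact_mod_cast mul_nonneg zero_le_two this
  · change g (star b * b) ≠ 0
    rw [hg _ (.star_mul_self b)]
    rw [map_neg] at hfb
    have : 0 < 2 * f (star b * b) := by linarith
    exact_mod_cast this.ne'

/-- For an approximate identity (e), the squared GNS norm of ey - y is f((ey - y)*(ey - y)), which
tends to 0 because a positive functional is continuous. -/
theorem gns_nondegenerate {B : Type w} [NonUnitalCStarAlgebra B] [PartialOrder B]
    [StarOrderedRing B] (f : B →ₚ[ℂ] ℂ) : IsNondegenerate f.gnsNonUnitalStarAlgHom := by
  obtain ⟨l, hl, -⟩ := exists_bounded_approximateUnit B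
  have := hl.neBot
  obtain ⟨C, hC⟩ := f.exists_norm_apply_le
  have hf : Continuous f := AddMonoidHomClass.continuous_of_bound f C hC
  set S := (Submodule.span ℂ
    {k : f.GNS | ∃ (b : B) (x : f.GNS), k = f.gnsNonUnitalStarAlgHom b x}).topologicalClosure
  have hcl : IsClosed (S : Set f.GNS) := Submodule.isClosed_topologicalClosure _
  suffices h : ∀ x, x ∈ S from eq_top_iff.2 fun x _ => h x
  intro x
  induction x using UniformSpace.Completion.induction_on with
  | hp => exact hcl
  | ih y =>
    have hlim : Tendsto (fun e => f.toPreGNS (e * f.ofPreGNS y)) l (𝓝 y) := by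
      rw [tendsto_iff_norm_sub_tendsto_zero]
      have hn : ∀ z : f.PreGNS,
          ‖z‖ = √(f (star (f.ofPreGNS z) * f.ofPreGNS z)).re := f.preGNS_norm_def
      have h1 : Tendsto (fun e => e * f.ofPreGNS y - f.ofPreGNS y) l (𝓝 0) := by
        simpa using (hl.tendsto_mul_right (f.ofPreGNS y)).sub_const (f.ofPreGNS y)
      have hcont : Continuous fun z : B => √(f (star z * z)).re :=
        Real.continuous_sqrt.comp (Complex.continuous_re.comp
          (hf.comp (continuous_star.mul continuous_id)))
      have h2 := (hcont.tendsto 0).comp h1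
      simp only [mul_zero, map_zero, Complex.zero_re, Real.sqrt_zero] at h2
      exact h2.congr fun e => by simp [hn]
    refine hcl.mem_of_tendsto
      (((UniformSpace.Completion.continuous_coe f.PreGNS).tendsto y).comp hlim)
      (Eventually.of_forall fun e => ?_)
    refine Submodule.le_topologicalClosure _ (Submodule.subset_span ⟨e, (y : f.GNS), ?_⟩)
    simp

/-- **Gelfand-Naimark**: every `C*`-algebra has a faithful non-degenerate representation. -/
theorem exists_faithful_rep (B : Type w) [NonUnitalCStarAlgebra B] :
    ∃ (H : Type w) (_ : NormedAddCommGroup H) (_ : InnerProductSpace ℂ H) (_ : CompleteSpace H)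
      (σ : B →⋆ₙₐ[ℂ] (H →L[ℂ] H)), Function.Injective σ ∧ IsNondegenerate σ := by
  let _ := CStarAlgebra.spectralOrder B
  let _ := CStarAlgebra.spectralOrderedRing B
  have hex : ∀ b : {b : B // b ≠ 0}, ∃ f : B →ₚ[ℂ] ℂ, f.gnsNonUnitalStarAlgHom b ≠ 0 := by
    rintro ⟨b, hb⟩
    -- Without a unit there is no cyclic vector at hand, so b is tested on the class of b*: its
    -- image is the class of bb*, and f is chosen to make that nonzero.
    have hbb : b * star b ≠ 0 := fun h => hb ((CStarRing.mul_star_self_eq_zero_iff _).1 h)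
    obtain ⟨f, hf⟩ := exists_positive_functional hbb
    refine ⟨f, fun h => hf ?_⟩
    have h1 : ((f.toPreGNS (b * star b) : f.PreGNS) : f.GNS) = 0 := by
      have := congrArg (fun T : f.GNS →L[ℂ] f.GNS => T ((f.toPreGNS (star b) : f.PreGNS))) h
      simpa using this
    have h2 := f.preGNS_norm_sq (f.toPreGNS (b * star b))
    rw [← UniformSpace.Completion.norm_coe, h1] at h2
    simpa using h2.symm
  choose f hf using hex
  exact ⟨lp (fun b => (f b).GNS) 2, inferInstance, inferInstance, inferInstance,
    directSumRep fun b => (f b).gnsNonUnitalStarAlgHom,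
    directSumRep_injective _ fun b hb => ⟨⟨b, hb⟩, hf ⟨b, hb⟩⟩,
    directSumRep_nondegenerate fun b => gns_nondegenerate (f b)⟩

end GelfandNaimark

/-! ### Calculus of the projections ᾱₛ(1). -/

section BarOne

variable {Γ : Type v} [AddCommGroup Γ] [LinearOrder Γ] [IsOrderedAddMonoid Γ]
variable {A : Type u} [NonUnitalCStarAlgebra A] {α : ExtendibleAction Γ A}

theorem barOne_fst_fst (s : PosCone Γ) (a : A) :
    (barOne α s).fst ((barOne α s).fst a) = (barOne α s).fst a :=
  congrArg (fun m : 𝓜(ℂ, A) => m.fst a) (barOne_spec α s).1.1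

theorem star_barOne (s : PosCone Γ) : star (barOne α s) = barOne α s := (barOne_spec α s).1.2

theorem barOne_snd (s : PosCone Γ) (a : A) :
    (barOne α s).snd a = star ((barOne α s).fst (star a)) := by
  conv_lhs => rw [← star_barOne]
  rfl

theorem star_barOne_fst_mul (s : PosCone Γ) (a b : A) :
    star ((barOne α s).fst a) * b = star a * (barOne α s).fst b := by
  rw [← (barOne α s).central, barOne_snd, star_star]

theorem act_mul_barOne_fst (s : PosCone Γ) (a b : A) :
    α.act s a * (barOne α s).fst b = α.act s a * b := by
  have h := star_barOne_fst_mul (α := α) s (α.act s (star a)) b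
  rw [(barOne_spec α s).fst_apply, map_star, star_star] at h
  exact h.symm

theorem star_barOne_fst_mul_act (s : PosCone Γ) (a b : A) :
    star ((barOne α s).fst a) * α.act s b = star a * α.act s b := by
  rw [star_barOne_fst_mul, (barOne_spec α s).fst_apply]

/-- `ᾱₛ(1)` is the strict limit of `αₛ(e)` along every bounded approximate identity. -/
theorem tendsto_act_mul {l : Filter A} (hl : l.IsApproximateUnit) (hb : ∀ᶠ e in l, ‖e‖ ≤ 1)
    (s : PosCone Γ) (b : A) :
    Tendsto (fun e => α.act s e * b) l (𝓝 ((barOne α s).fst b)) := by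
  have hcl := isClosed_setOf_tendsto (fun e => ContinuousLinearMap.mul ℂ A (α.act s e))
    (barOne α s).fst l 1 (hb.mono fun e he =>
      (ContinuousLinearMap.opNorm_mul_apply_le ℂ A _).trans
        ((NonUnitalStarAlgHom.norm_apply_le (α.act s) e).trans he))
  obtain ⟨-, l', hl', hp⟩ := barOne_spec α s
  have := hl'.neBot
  -- The convergence is clear on αₛ(a)b and passes to the limit ᾱₛ(1)b. It then holds at b itself
  -- because αₛ(e)ᾱₛ(1) = αₛ(e).
  have hmem := hcl.mem_of_tendsto (hp b).1 (Eventually.of_forall fun a => by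
    change Tendsto (fun e => α.act s e * (α.act s a * b)) l (𝓝 _)
    rw [fst_mul, (barOne_spec α s).fst_apply]
    have := (((continuous_hom (α.act s)).tendsto a).comp (hl.tendsto_mul_right a)).mul_const b
    simpa [Function.comp_def, mul_assoc] using this)
  change Tendsto (fun e => α.act s e * _) l (𝓝 _) at hmem
  simpa only [act_mul_barOne_fst, barOne_fst_fst] using hmem

theorem barOne_add_fst_act (s t : PosCone Γ) (a : A) :
    (barOne α (s + t)).fst (α.act t a) = α.act t ((barOne α s).fst a) := by
  have h := barOne_add_fst α (s := s) (t := t) ⟨(barOne α s).fst a, mem_fiber.2 (barOne_fst_fst s a)⟩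
  obtain ⟨l, hl, hb⟩ := exists_bounded_approximateUnit A
  have := hl.neBot
  have h1 := tendsto_act_mul (α := α) hl hb (s + t) (α.act t a)
  have h2 := tendsto_act_mul (α := α) hl hb (s + t) (α.act t ((barOne α s).fst a))
  rw [h] at h2
  refine tendsto_nhds_unique h1 (h2.congr fun e => ?_)
  rw [add_comm s t, α.act_add, ← map_mul, act_mul_barOne_fst, map_mul]

/-- The projections decrease: αₛ₊ₜ(e) = αₜ(αₛ(e)) absorbs ᾱₜ(1) on its right, and so does the strict
limit. -/
theorem barOne_add_fst_barOne (s t : PosCone Γ) (a : A) :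
    (barOne α (s + t)).fst ((barOne α t).fst a) = (barOne α (s + t)).fst a := by
  obtain ⟨l, hl, hb⟩ := exists_bounded_approximateUnit A
  have := hl.neBot
  have h1 := tendsto_act_mul (α := α) hl hb (s + t) ((barOne α t).fst a)
  refine tendsto_nhds_unique h1 ((tendsto_act_mul hl hb (s + t) a).congr fun e => ?_)
  rw [add_comm s t, α.act_add, act_mul_barOne_fst]

theorem barOne_zero_fst (a : A) : (barOne α 0).fst a = a := mem_fiber.1 (ofA α a).2

end BarOne

/-! ### Algebra of covariant pairs. -/

section CovariantPair

variable {Γ : Type v} [AddCommGroup Γ] [LinearOrder Γ] [IsOrderedAddMonoid Γ]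
variable {A : Type u} [NonUnitalCStarAlgebra A] {α : ExtendibleAction Γ A}
variable {C : Type w} [CStarAlgebra C] {π : A →⋆ₙₐ[ℂ] C} {V : PosCone Γ → C}

namespace IsCovariantPair

/-- Write Vₛ = VₛVₛ*Vₛ and move Vₛ*Vₛ past π(a). -/
theorem mul_map (h : IsCovariantPair α π V) (s : PosCone Γ) (a : A) :
    V s * π a = π (α.act s a) * V s := by
  rw [h.conj, mul_assoc, mul_assoc, ← mul_assoc (π a), mul_assoc (π a), ← h.comm, ← mul_assoc,
    ← mul_assoc, h.partial_isometry]

theorem map_mul_star (h : IsCovariantPair α π V) (s : PosCone Γ) (a : A) :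
    π a * star (V s) = star (V s) * π (α.act s a) := by
  simpa [map_star π, map_star (α.act s)] using congrArg star (h.mul_map s (star a))

/-- V₀ = 1 is not an axiom, but V₀ is idempotent and π(a) = V₀π(a)V₀*. -/
theorem zero_mul_map (h : IsCovariantPair α π V) (a : A) : V 0 * π a = π a := by
  have h1 := h.conj 0 a
  have h2 := h.map_add 0 0
  rw [add_zero] at h2
  rw [α.act_zero] at h1
  rw [h1, ← mul_assoc, ← mul_assoc, h2]

theorem map_mul_star_zero (h : IsCovariantPair α π V) (a : A) : π a * star (V 0) = π a := by
  simpa [map_star π] using congrArg star (h.zero_mul_map (star a))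

theorem star_zero_mul_map (h : IsCovariantPair α π V) (a : A) : star (V 0) * π a = π a := by
  have := h.map_mul_star 0 a
  rw [α.act_zero, h.map_mul_star_zero] at this
  exact this.symm

theorem map_mul_zero (h : IsCovariantPair α π V) (a : A) : π a * V 0 = π a := by
  simpa [map_star π] using congrArg star (h.star_zero_mul_map (star a))

/-- VₛVₛ* fixes π(αₛ(e)a) = Vₛπ(e)Vₛ*π(a). No non-degeneracy is needed on this range. -/
theorem mul_star_mul_map_barOne (h : IsCovariantPair α π V) (s : PosCone Γ) (a : A) :
    V s * star (V s) * π ((barOne α s).fst a) = π ((barOne α s).fst a) := by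
  obtain ⟨l, hl, hb⟩ := exists_bounded_approximateUnit A
  have := hl.neBot
  have h1 := ((continuous_hom π).tendsto _).comp (tendsto_act_mul (α := α) hl hb s a)
  refine tendsto_nhds_unique (h1.const_mul (V s * star (V s))) (h1.congr fun e => ?_)
  simp only [Function.comp_apply, map_mul, h.conj, ← mul_assoc, h.partial_isometry]

/-- For a non-degenerate pair, `Vₛ* π(a)` only depends on `ᾱₛ(1) a`. -/
theorem star_mul_map_barOne (h : IsCovariantPair α π V)
    (hN : ∀ m : C, (∀ a, m * π a = 0) → m = 0) (s : PosCone Γ) (a : A) :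
    star (V s) * π ((barOne α s).fst a) = star (V s) * π a := by
  -- Moving π(c) past Vₛ* turns it into π(αₛ(c)), and αₛ(c) kills a - ᾱₛ(1)a.
  have key : ∀ c, π c * (star (V s) * π (a - (barOne α s).fst a)) = 0 := fun c => by
    rw [← mul_assoc, h.map_mul_star, mul_assoc, ← map_mul, mul_sub, act_mul_barOne_fst, sub_self,
      map_zero, mul_zero]
  have h2 : star (star (V s) * π (a - (barOne α s).fst a)) = 0 := hN _ fun c => by
    simpa [map_star π] using congrArg star (key (star c))
  have h3 := star_eq_zero.1 h2
  rw [map_sub, mul_sub, sub_eq_zero] at h3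
  exact h3.symm

theorem mul_star_mul_map (h : IsCovariantPair α π V)
    (hN : ∀ m : C, (∀ a, m * π a = 0) → m = 0) (s : PosCone Γ) (a : A) :
    V s * star (V s) * π a = π ((barOne α s).fst a) := by
  rw [mul_assoc, ← h.star_mul_map_barOne hN, ← mul_assoc, h.mul_star_mul_map_barOne]

theorem map_mul_mul_star (h : IsCovariantPair α π V)
    (hN : ∀ m : C, (∀ a, m * π a = 0) → m = 0) (s : PosCone Γ) (a : A) :
    π a * (V s * star (V s)) = π (star ((barOne α s).fst (star a))) := by
  simpa [mul_assoc, map_star π] using congrArg star (h.mul_star_mul_map hN s (star a))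

theorem star_add (h : IsCovariantPair α π V) (s t : PosCone Γ) :
    star (V (s + t)) = star (V s) * star (V t) := by
  rw [add_comm, ← h.map_add, star_mul]

/-- The products of elements `Vₛ* π(a) Vₜ` have the same form. -/
theorem exists_mul_eq (h : IsCovariantPair α π V)
    (hN : ∀ m : C, (∀ a, m * π a = 0) → m = 0) (s t r q : PosCone Γ) (a b : A) :
    ∃ (s' t' : PosCone Γ) (c : A), star (V s) * π a * V t * (star (V r) * π b * V q) =
      star (V s') * π c * V t' := by
  -- The larger middle index is split as d plus the smaller one. The resulting range projection is
  -- absorbed as ᾱ(1), and the remaining V_d or V_d* is moved past π.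
  rcases le_total r t with hrt | htr
  · obtain ⟨d, rfl⟩ : ∃ d : PosCone Γ, t = d + r :=
      ⟨⟨t.1 - r.1, sub_nonneg.2 hrt⟩, Subtype.ext (sub_add_cancel _ _).symm⟩
    refine ⟨s, d + q, a * α.act d ((barOne α r).fst b), ?_⟩
    calc _ = star (V s) * π a * V d * (V r * star (V r) * π b) * V q := by
          rw [← h.map_add]; simp only [mul_assoc]
      _ = star (V s) * π a * (V d * π ((barOne α r).fst b)) * V q := by
          rw [h.mul_star_mul_map hN]; simp only [mul_assoc]
      _ = _ := by rw [h.mul_map, ← h.map_add, map_mul]; simp only [mul_assoc]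
  · obtain ⟨d, rfl⟩ : ∃ d : PosCone Γ, r = d + t :=
      ⟨⟨r.1 - t.1, sub_nonneg.2 htr⟩, Subtype.ext (sub_add_cancel _ _).symm⟩
    refine ⟨d + s, q, α.act d (star ((barOne α t).fst (star a))) * b, ?_⟩
    calc _ = star (V s) * (π a * (V t * star (V t))) * star (V d) * π b * V q := by
          rw [add_comm d t, h.star_add]; simp only [mul_assoc]
      _ = star (V s) * (π (star ((barOne α t).fst (star a))) * star (V d)) * π b * V q := by
          rw [h.map_mul_mul_star hN]; simp only [mul_assoc]
      _ = _ := by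
          rw [h.map_mul_star, add_comm d s, h.star_add, map_mul]; simp only [mul_assoc]

/-- The Toeplitz representation `ψₛ(x) = Vₛ* π(x)`, in a `C*`-subalgebra that contains it. -/
def toeplitzRep (h : IsCovariantPair α π V) {B : Type z} [NonUnitalCStarAlgebra B]
    (j : B →⋆ₙₐ[ℂ] C) (hj : Function.Injective j) (f : PosCone Γ → A →ₗ[ℂ] B) (k : A →⋆ₙₐ[ℂ] B)
    (hk : ∀ a, j (k a) = π a) (hf : ∀ s a, j (f s a) = star (V s) * π a) : ToeplitzRep α B where
  map s := (f s).comp (Fiber α s).subtype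
  hom := k
  hom_eq a := hj (by simp [hk, hf, ofA, h.star_zero_mul_map])
  map_rightAct s x a := hj (by simp [hk, hf, rightAct, mul_assoc])
  map_ip s x y := hj (by
    -- Here (Vₛ*π(x))*(Vₛ*π(y)) = π(x)*VₛVₛ*π(y), and VₛVₛ* fixes π(y) because y lies in the fibre.
    have := h.mul_star_mul_map_barOne s y
    rw [mem_fiber.1 y.2, mul_assoc] at this
    simp [hk, hf, ip, mul_assoc, this, map_star j, map_star π])
  map_leftAct s a x := hj (by
    simp only [LinearMap.comp_apply, Submodule.subtype_apply, hf, hk, leftAct, map_mul,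
      ← mul_assoc, h.map_mul_star])
  map_mulX s t x y := hj (by
    simp only [LinearMap.comp_apply, Submodule.subtype_apply, hf, mulX, map_mul, h.star_add]
    rw [mul_assoc, ← mul_assoc (star (V t)), ← h.map_mul_star]
    simp only [mul_assoc])

end IsCovariantPair

end CovariantPair

/-! ### Separation of multipliers by a non-degenerate homomorphism. -/

section Nondegenerate

variable {A : Type u} [NonUnitalCStarAlgebra A] {B : Type w} [NonUnitalCStarAlgebra B]

theorem multiplier_eq_zero {f : A →⋆ₙₐ[ℂ] B}
    (hf : (Submodule.span ℂ {c : B | ∃ (a : A) (b : B), c = f a * b}).topologicalClosure = ⊤)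
    (m : 𝓜(ℂ, B)) (h : ∀ a, m * (f a : 𝓜(ℂ, B)) = 0) : m = 0 := by
  have hle : (Submodule.span ℂ {c : B | ∃ (a : A) (b : B), c = f a * b}).topologicalClosure ≤
      LinearMap.ker (m.fst : B →ₗ[ℂ] B) := by
    refine Submodule.topologicalClosure_minimal _ (Submodule.span_le.2 ?_)
      (isClosed_singleton.preimage m.fst.continuous)
    rintro _ ⟨a, b, rfl⟩
    exact congrArg (fun n : 𝓜(ℂ, B) => n.fst b) (h a)
  exact multiplier_ext fun b => hle (hf ▸ Submodule.mem_top : b ∈ _)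

end Nondegenerate

/-! ### From a Toeplitz representation to partial isometries. -/

section ToeplitzRepresentation

variable {Γ : Type v} [AddCommGroup Γ] [LinearOrder Γ] [IsOrderedAddMonoid Γ]
variable {A : Type u} [NonUnitalCStarAlgebra A] {α : ExtendibleAction Γ A}
variable {B : Type w} [NonUnitalCStarAlgebra B]

namespace ToeplitzRep

/-- The extension `a ↦ ψₛ(ᾱₛ(1) a)` of `ψₛ` to `A`. -/
def ext (ψ : ToeplitzRep α B) (s : PosCone Γ) : A →ₗ[ℂ] B :=
  (ψ.map s).comp (barOne α s).fst.toLinearMap.rangeRestrict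

variable (ψ : ToeplitzRep α B)

theorem ext_eq {s : PosCone Γ} {a : A} (x : Fiber α s) (h : (x : A) = (barOne α s).fst a) :
    ψ.ext s a = ψ.map s x :=
  congrArg (ψ.map s) (Subtype.ext h.symm)

theorem ext_coe {s : PosCone Γ} (x : Fiber α s) : ψ.ext s x = ψ.map s x :=
  ψ.ext_eq x (mem_fiber.1 x.2).symm

theorem exists_fiber (s : PosCone Γ) (a : A) : ∃ x : Fiber α s, (x : A) = (barOne α s).fst a :=
  ⟨⟨_, mem_fiber.2 (barOne_fst_fst s a)⟩, rfl⟩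

theorem norm_ext_le (s : PosCone Γ) (a : A) : ‖ψ.ext s a‖ ≤ ‖a‖ := by
  obtain ⟨x, hx⟩ := exists_fiber (α := α) s a
  rw [ψ.ext_eq x hx]
  refine (ψ.norm_le s x).trans ?_
  -- For x = ᾱₛ(1)a, with ᾱₛ(1) a projection, x*x = x*a.
  have h : ‖(x : A)‖ * ‖(x : A)‖ ≤ ‖(x : A)‖ * ‖a‖ := by
    rw [← CStarRing.norm_star_mul_self]
    conv_lhs => rw [hx, star_barOne_fst_mul, barOne_fst_fst, ← hx]
    rw [← norm_star a, mul_comm]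
    conv_lhs => rw [hx, ← star_barOne_fst_mul, ← hx]
    rw [norm_star, mul_comm, ← norm_star (x : A)]
    exact norm_mul_le _ _
  rcases eq_or_lt_of_le (norm_nonneg (x : A)) with h0 | h0
  · rw [← h0]
    exact norm_nonneg _
  · exact le_of_mul_le_mul_left h h0

theorem continuous_ext (s : PosCone Γ) : Continuous (ψ.ext s) :=
  AddMonoidHomClass.continuous_of_bound (ψ.ext s) 1 fun a => by
    simpa using ψ.norm_ext_le s a

theorem ext_barOne (s : PosCone Γ) (a : A) : ψ.ext s ((barOne α s).fst a) = ψ.ext s a := by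
  obtain ⟨x, hx⟩ := exists_fiber (α := α) s a
  rw [← hx, ψ.ext_coe, ψ.ext_eq x hx]

theorem ext_mul_hom (s : PosCone Γ) (a b : A) : ψ.ext s a * ψ.hom b = ψ.ext s (a * b) := by
  obtain ⟨x, hx⟩ := exists_fiber (α := α) s a
  rw [ψ.ext_eq x hx, ← ψ.map_rightAct, ψ.ext_eq]
  rw [fst_mul, ← hx]
  rfl

theorem hom_mul_ext (s : PosCone Γ) (a b : A) :
    ψ.hom a * ψ.ext s b = ψ.ext s (α.act s a * b) := by
  obtain ⟨x, hx⟩ := exists_fiber (α := α) s b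
  rw [ψ.ext_eq x hx, ← ψ.map_leftAct, ψ.ext_eq]
  rw [fst_mul, (barOne_spec α s).fst_apply, ← act_mul_barOne_fst, ← hx]
  rfl

theorem star_ext_mul_ext (s : PosCone Γ) (a b : A) :
    star (ψ.ext s a) * ψ.ext s b = ψ.hom (star a * (barOne α s).fst b) := by
  obtain ⟨x, hx⟩ := exists_fiber (α := α) s a
  obtain ⟨y, hy⟩ := exists_fiber (α := α) s b
  rw [ψ.ext_eq x hx, ψ.ext_eq y hy, ψ.map_ip, ip, hx, star_barOne_fst_mul, hy, barOne_fst_fst]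

theorem ext_mul_ext (s t : PosCone Γ) (a b : A) :
    ψ.ext s a * ψ.ext t b = ψ.ext (s + t) (α.act t a * b) := by
  obtain ⟨x, hx⟩ := exists_fiber (α := α) s a
  obtain ⟨y, hy⟩ := exists_fiber (α := α) t b
  rw [ψ.ext_eq x hx, ψ.ext_eq y hy, ← ψ.map_mulX, ψ.ext_eq]
  rw [fst_mul, barOne_add_fst_act, ← hx, ← act_mul_barOne_fst, ← hy]
  rfl

theorem tendsto_ext_act {l : Filter A} (hl : l.IsApproximateUnit) (hb : ∀ᶠ e in l, ‖e‖ ≤ 1)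
    (s : PosCone Γ) (a : A) :
    Tendsto (fun e => ψ.ext s (α.act s e * a)) l (𝓝 (ψ.ext s a)) := by
  rw [← ψ.ext_barOne s a]
  exact ((ψ.continuous_ext s).tendsto _).comp (tendsto_act_mul hl hb s a)

/-- The element ψₜ₊ᵣ(b) is the limit of ψₜ₊ᵣ(αₜ₊ᵣ(e)b) = ψₜ(αₜ(e))ψᵣ(b), and on the first factor the
inner product formula applies. -/
theorem star_ext_mul_ext_add (t r : PosCone Γ) (y b : A) :
    star (ψ.ext t y) * ψ.ext (t + r) b =
      ψ.ext r (α.act r (star ((barOne α t).fst y)) * b) := by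
  obtain ⟨l, hl, hb⟩ := exists_bounded_approximateUnit A
  have := hl.neBot
  refine tendsto_nhds_unique ((ψ.tendsto_ext_act hl hb (t + r) b).const_mul _) ?_
  have h1 := tendsto_act_mul (α := α) hl hb (t + r)  b
  have h2 : Tendsto (fun e => ψ.ext r (α.act r (star ((barOne α t).fst y)) *
      (α.act (t + r) e * b)))
      l (𝓝 (ψ.ext r (α.act r (star ((barOne α t).fst y)) * (barOne α (t + r)).fst b))) :=
    ((ψ.continuous_ext r).tendsto _).comp (h1.const_mul _)
  have h3 : α.act r (star ((barOne α t).fst y)) * (barOne α (t + r)).fst b =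
      α.act r (star ((barOne α t).fst y)) * b := by
    rw [map_star, ← barOne_add_fst_act, star_barOne_fst_mul, barOne_fst_fst,
      ← star_barOne_fst_mul]
  rw [h3] at h2
  refine h2.congr fun e => ?_
  rw [add_comm t r, α.act_add, ← mul_assoc, ← map_mul, star_barOne_fst_mul_act, add_comm r t,
    ← ψ.ext_mul_ext, ← mul_assoc, star_ext_mul_ext, (barOne_spec α t).fst_apply, hom_mul_ext]

variable (hψ : ∀ S : NonUnitalStarSubalgebra ℂ B, IsClosed (S : Set B) →
  (∀ s x, ψ.map s x ∈ S) → S = ⊤)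

include hψ

/-- For a closed right ideal R, the elements c with c and c* in R form a closed *-subalgebra. Hence
only the generators and their adjoints need to be tested. -/
theorem rightIdeal_eq_top (R : Submodule ℂ B) (hR : IsClosed (R : Set B))
    (hmul : ∀ c ∈ R, ∀ b, c * b ∈ R) (h : ∀ s a, ψ.ext s a ∈ R)
    (h' : ∀ s a, star (ψ.ext s a) ∈ R) : R = ⊤ := by
  let S : NonUnitalStarSubalgebra ℂ B :=
    { carrier := {c | c ∈ R ∧ star c ∈ R}
      add_mem' := fun {c d} hc hd => ⟨R.add_mem hc.1 hd.1, by
        rw [star_add]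
        exact R.add_mem hc.2 hd.2⟩
      zero_mem' := ⟨R.zero_mem, by
        rw [star_zero]
        exact R.zero_mem⟩
      mul_mem' := fun {c d} hc hd => ⟨hmul c hc.1 d, by
        rw [star_mul]
        exact hmul _ hd.2 _⟩
      smul_mem' := fun k c hc => ⟨R.smul_mem k hc.1, by
        rw [star_smul]
        exact R.smul_mem _ hc.2⟩
      star_mem' := fun {c} hc => ⟨hc.2, by
        rw [star_star]
        exact hc.1⟩ }
  have hS : S = ⊤ := hψ S (hR.inter (hR.preimage continuous_star)) fun s x => by
    rw [← ψ.ext_coe]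
    exact ⟨h s x, h' s x⟩
  refine eq_top_iff.2 fun b _ => ?_
  have hb : b ∈ S := hS ▸ trivial
  exact hb.1

/-- Approximation of generators: ψ₀(e)ψₛ(a) = ψₛ(αₛ(e)a) → ψₛ(a), and ψ₀(e*)ψₛ(a)* = ψₛ(ae)* →
ψₛ(a)*. -/
theorem hom_nondegenerate :
    (Submodule.span ℂ {c : B | ∃ (a : A) (b : B), c = ψ.hom a * b}).topologicalClosure = ⊤ := by
  obtain ⟨l, hl, hb⟩ := exists_bounded_approximateUnit A
  have := hl.neBot
  set R := (Submodule.span ℂ {c : B | ∃ (a : A) (b : B), c = ψ.hom a * b}).topologicalClosure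
  have hR : IsClosed (R : Set B) := Submodule.isClosed_topologicalClosure _
  have hmem : ∀ a b, ψ.hom a * b ∈ R := fun a b =>
    Submodule.le_topologicalClosure _ (Submodule.subset_span ⟨a, b, rfl⟩)
  refine ψ.rightIdeal_eq_top hψ R hR (fun c hc b => ?_) (fun s a => ?_) (fun s a => ?_)
  · have hle : R ≤ R.comap (LinearMap.mulRight ℂ b) := by
      refine Submodule.topologicalClosure_minimal _ (Submodule.span_le.2 ?_)
        (hR.preimage (continuous_mul_const b))
      rintro _ ⟨a, d, rfl⟩
      change ψ.hom a * d * b ∈ R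
      rw [mul_assoc]
      exact hmem _ _
    exact hle hc
  · refine hR.mem_of_tendsto (ψ.tendsto_ext_act hl hb s a) (Eventually.of_forall fun e => ?_)
    rw [← hom_mul_ext]
    exact hmem _ _
  · have h1 : Tendsto (fun e => star (ψ.ext s (a * e))) l (𝓝 (star (ψ.ext s a))) :=
      (continuous_star.tendsto _).comp
        (((ψ.continuous_ext s).tendsto _).comp (hl.tendsto_mul_left a))
    refine hR.mem_of_tendsto h1 (Eventually.of_forall fun e => ?_)
    rw [← ext_mul_hom, star_mul, ← map_star]
    exact hmem _ _

/-- The multiplier is the strict limit of ψₛ(e), with ψₛ extended to A. The set where products with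
ψₛ(e) or ψₛ(e)* converge is a closed right ideal, which leaves four cases: each of these against
ψₜ(a) and ψₜ(a)*. -/
theorem exists_multiplier (s : PosCone Γ) :
    ∃ W : 𝓜(ℂ, B), ∀ a, W.fst (ψ.hom a) = ψ.ext s a := by
  obtain ⟨l, hl, hb⟩ := exists_bounded_approximateUnit A
  have := hl.neBot
  have hC : ∀ᶠ e in l, ‖ψ.ext s e‖ ≤ 1 := hb.mono fun e he => (ψ.norm_ext_le s e).trans he
  have hR : ∀ y : A → B, (∀ᶠ e in l, ‖y e‖ ≤ 1) →
      (∀ t a, ∃ d, Tendsto (fun e => y e * ψ.ext t a) l (𝓝 d)) →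
      (∀ t a, ∃ d, Tendsto (fun e => y e * star (ψ.ext t a)) l (𝓝 d)) →
      convergenceDomain (fun e => ContinuousLinearMap.mul ℂ B (y e)) l = ⊤ := fun y hy h1 h2 => by
    refine ψ.rightIdeal_eq_top hψ _ (isClosed_convergenceDomain _ l 1 (hy.mono fun e he =>
      (ContinuousLinearMap.opNorm_mul_apply_le ℂ B _).trans he)) (fun c hc b => ?_) h1 h2
    obtain ⟨d, hd⟩ := hc
    refine ⟨d * b, (hd.mul_const b).congr fun e => ?_⟩
    exact mul_assoc _ _ _
  suffices h : ∃ W : 𝓜(ℂ, B), ∀ c, Tendsto (fun e => ψ.ext s e * c) l (𝓝 (W.fst c)) ∧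
      Tendsto (fun e => c * ψ.ext s e) l (𝓝 (W.snd c)) by
    obtain ⟨W, hW⟩ := h
    refine ⟨W, fun a => tendsto_nhds_unique (hW (ψ.hom a)).1 ?_⟩
    have := ((ψ.continuous_ext s).tendsto _).comp (hl.tendsto_mul_right a)
    refine this.congr fun e => ?_
    rw [ext_mul_hom]
    rfl
  refine exists_strictLimit (ψ.ext s) l 1 hC
    (hR _ hC (fun t a => ⟨ψ.ext (s + t) ((barOne α t).fst a), ?_⟩) (fun t a => ?_))
    (hR _ (hC.mono fun e he => (norm_star _).trans_le he) (fun t a => ?_)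
      (fun t a => ⟨star (ψ.ext (t + s) (α.act s a)), ?_⟩))
  · refine (((ψ.continuous_ext (s + t)).tendsto _).comp
      (tendsto_act_mul hl hb t a)).congr fun e => ?_
    rw [ext_mul_ext]
    rfl
  -- Approximating ψₜ(a)* by ψₜ(ad)* = ψ₀(d*)ψₜ(a)* lets ψₛ(e) absorb ψ₀(d*), and ψₛ(ed*) → ψₛ(d*).
  · have hcl := isClosed_convergenceDomain (fun e => ContinuousLinearMap.mul ℂ B (ψ.ext s e)) l 1
      (hC.mono fun e he => (ContinuousLinearMap.opNorm_mul_apply_le ℂ B _).trans he)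
    have h1 : Tendsto (fun e => star (ψ.ext t (a * e))) l (𝓝 (star (ψ.ext t a))) :=
      (continuous_star.tendsto _).comp
        (((ψ.continuous_ext t).tendsto _).comp (hl.tendsto_mul_left a))
    refine hcl.mem_of_tendsto h1 (Eventually.of_forall fun d => ?_)
    refine ⟨ψ.ext s (star d) * star (ψ.ext t a), ?_⟩
    have := (((ψ.continuous_ext s).tendsto _).comp
      (hl.tendsto_mul_right (star d))).mul_const (star (ψ.ext t a))
    refine this.congr fun e => ?_
    rw [ContinuousLinearMap.mul_apply', ← ψ.ext_mul_hom t, star_mul, ← map_star ψ.hom, ← mul_assoc,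
      ext_mul_hom]
    rfl
  -- If t = s + r, then ψₜ(a) is approximated by ψₛ(αₛ(d))ψᵣ(a), and ψₛ(e)*ψₛ(αₛ(d)) = ψ₀(e*αₛ(d)).
  -- If s = t + r, the product is the adjoint of ψₜ(a)*ψₜ₊ᵣ(e), which has a closed form.
  · rcases le_total s t with hst | hts
    · obtain ⟨r, rfl⟩ : ∃ r : PosCone Γ, t = s + r :=
        ⟨⟨t.1 - s.1, sub_nonneg.2 hst⟩, Subtype.ext (add_sub_cancel _ _).symm⟩
      have hcl := isClosed_convergenceDomain
        (fun e => ContinuousLinearMap.mul ℂ B (star (ψ.ext s e))) l 1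
        (hC.mono fun e he => (ContinuousLinearMap.opNorm_mul_apply_le ℂ B _).trans
          ((norm_star _).trans_le he))
      refine hcl.mem_of_tendsto (ψ.tendsto_ext_act hl hb (s + r) a)
        (Eventually.of_forall fun d => ⟨ψ.hom (α.act s d) * ψ.ext r a, ?_⟩)
      have h1 : Tendsto (fun e => star e * α.act s d) l (𝓝 (α.act s d)) := by
        simpa [Function.comp_def] using
          (continuous_star.tendsto _).comp (hl.tendsto_mul_left (star (α.act s d)))
      refine ((((continuous_hom ψ.hom).tendsto _).comp h1).mul_const (ψ.ext r a)).congr fun e => ?_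
      rw [ContinuousLinearMap.mul_apply', add_comm s r, α.act_add, add_comm r s, ← ext_mul_ext,
        ← mul_assoc, star_ext_mul_ext, (barOne_spec α s).fst_apply]
      rfl
    · obtain ⟨r, rfl⟩ : ∃ r : PosCone Γ, s = t + r :=
        ⟨⟨s.1 - t.1, sub_nonneg.2 hts⟩, Subtype.ext (add_sub_cancel _ _).symm⟩
      refine ⟨star (ψ.ext r (α.act r (star ((barOne α t).fst a)))), ?_⟩
      refine ((continuous_star.tendsto _).comp
        (((ψ.continuous_ext r).tendsto _).comp (hl.tendsto_mul_left _))).congr fun e => ?_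
      rw [← star_star (ψ.ext t a), ← star_mul, star_ext_mul_ext_add]
      rfl
  · refine ((continuous_star.tendsto _).comp
      (((ψ.continuous_ext (t + s)).tendsto _).comp (hl.tendsto_mul_left _))).congr fun e => ?_
    rw [← star_mul, ext_mul_ext]
    rfl

/-- A Toeplitz representation that generates `B` comes from partial isometries in `M(B)`. -/
theorem exists_isCovariantIn : ∃ V : PosCone Γ → 𝓜(ℂ, B), IsCovariantIn α ψ.hom V ∧
    ∀ s a, star (V s) * (ψ.hom a : 𝓜(ℂ, B)) = (ψ.ext s a : 𝓜(ℂ, B)) := by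
  choose W hW using ψ.exists_multiplier hψ
  have hnd := ψ.hom_nondegenerate hψ
  have hext : ∀ m n : 𝓜(ℂ, B), (∀ a, m * (ψ.hom a : 𝓜(ℂ, B)) = n * (ψ.hom a : 𝓜(ℂ, B))) →
      m = n := fun m n h => sub_eq_zero.1 (multiplier_eq_zero hnd _ fun a => by
    rw [sub_mul, h, sub_self])
  have hc : ∀ s a, W s * (ψ.hom a : 𝓜(ℂ, B)) = (ψ.ext s a : 𝓜(ℂ, B)) := fun s a => by
    rw [mul_coe, hW]
  have hmul : ∀ a b, (ψ.hom a : 𝓜(ℂ, B)) * (ψ.hom b : 𝓜(ℂ, B)) =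
      (ψ.hom (a * b) : 𝓜(ℂ, B)) := fun a b => by rw [map_mul, coe_mul]
  have hstar : ∀ a, star (ψ.hom a : 𝓜(ℂ, B)) = (ψ.hom (star a) : 𝓜(ℂ, B)) := fun a => by
    rw [map_star, coe_star]
  have hcomm : ∀ s a, (ψ.hom a : 𝓜(ℂ, B)) * W s = W s * (ψ.hom (α.act s a) : 𝓜(ℂ, B)) :=
    fun s a => hext _ _ fun b => by
      rw [mul_assoc, mul_assoc, hmul, hc, hc, ← coe_mul, hom_mul_ext]
  have hcomm' : ∀ s a, star (W s) * (ψ.hom a : 𝓜(ℂ, B)) =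
      (ψ.hom (α.act s a) : 𝓜(ℂ, B)) * star (W s) := fun s a => by
    have := congrArg star (hcomm s (star a))
    rwa [star_mul, star_mul, hstar, hstar, map_star (α.act s), star_star, star_star] at this
  -- Wₛ*Wₛ acts on ψ₀(A) as the projection ᾱₛ(1). This is what makes Wₛ a partial isometry.
  have hiso : ∀ s a, star (W s) * (W s * (ψ.hom a : 𝓜(ℂ, B))) =
      (ψ.hom ((barOne α s).fst a) : 𝓜(ℂ, B)) := fun s a => by
    refine star_injective (hext _ _ fun b => ?_)
    rw [star_mul, star_star, hc, mul_assoc, hc, ← coe_star, ← coe_mul, star_ext_mul_ext, hstar,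
      hmul, star_barOne_fst_mul]
  refine ⟨fun s => star (W s), ⟨hnd, fun s => ?_, fun s t => ?_, fun s a => ?_, fun s a => ?_⟩,
    fun s a => by rw [star_star, hc]⟩
  · rw [star_star]
    refine star_injective (hext _ _ fun a => ?_)
    rw [star_mul, star_mul, star_star, mul_assoc, mul_assoc, hiso, hc, hc, ext_barOne]
  -- The claim is WₜWₛ = Wₛ₊ₜ. On approximants Wₜψ₀(e)ψₛ(a) = ψₜ(e)ψₛ(a) = ψₛ₊ₜ(αₛ(e)a), with limit
  -- ψₛ₊ₜ(a) because ᾱₛ₊ₜ(1)ᾱₛ(1) = ᾱₛ₊ₜ(1).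
  · rw [← star_mul]
    refine congrArg star (hext _ _ fun a => ?_)
    obtain ⟨l, hl, hb⟩ := exists_bounded_approximateUnit A
    have := hl.neBot
    rw [mul_assoc, hc, hc, mul_coe]
    refine congrArg _ (tendsto_nhds_unique (((W t).fst.continuous.tendsto _).comp
      (ψ.tendsto_ext_act hl hb s a)) ?_)
    have h1 : Tendsto (fun e => ψ.ext (t + s) (α.act s e * a)) l
        (𝓝 (ψ.ext (t + s) ((barOne α s).fst a))) :=
      ((ψ.continuous_ext _).tendsto _).comp (tendsto_act_mul hl hb s a)
    rw [← ext_barOne, barOne_add_fst_barOne, ext_barOne, add_comm] at h1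
    refine h1.congr fun e => coe_injective ?_
    change ((ψ.ext (s + t) (α.act s e * a) : B) : 𝓜(ℂ, B)) =
      (((W t).fst (ψ.ext s (α.act s e * a)) : B) : 𝓜(ℂ, B))
    rw [← mul_coe, ← hom_mul_ext, coe_mul, ← mul_assoc, hc, ← coe_mul, ext_mul_ext, add_comm]
  · change (ψ.hom _ : 𝓜(ℂ, B)) = _ * (ψ.hom a : 𝓜(ℂ, B)) * _
    rw [star_star, mul_assoc, hcomm, hiso, (barOne_spec α s).fst_apply]
  · change _ * (ψ.hom a : 𝓜(ℂ, B)) = (ψ.hom a : 𝓜(ℂ, B)) * _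
    rw [star_star, mul_assoc, hcomm', ← mul_assoc, ← hcomm, mul_assoc]

end ToeplitzRep
end ToeplitzRepresentation

/-! ### The closed span of the elements Vₛ*π(a)Vₜ. -/

section ClosedSpan

variable {Γ : Type v} [AddCommGroup Γ] [LinearOrder Γ]
variable {A : Type u} [NonUnitalCStarAlgebra A]

/-- The closed span of a self-adjoint multiplicative set is a `*`-subalgebra. -/
theorem exists_starSubalgebra_closure_span {C : Type w} [CStarAlgebra C] (G : Set C)
    (hmul : ∀ x ∈ G, ∀ y ∈ G, x * y ∈ G) (hstar : ∀ x ∈ G, star x ∈ G) :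
    ∃ S : NonUnitalStarSubalgebra ℂ C, (S : Set C) = closure (Submodule.span ℂ G : Set C) := by
  have h1 : ∀ x ∈ Submodule.span ℂ G, ∀ y ∈ Submodule.span ℂ G, x * y ∈ Submodule.span ℂ G := by
    intro x hx y hy
    have h := Submodule.mul_mem_mul hx hy
    rw [Submodule.span_mul_span] at h
    refine Submodule.span_mono ?_ h
    rintro _ ⟨a, ha, b, hb, rfl⟩
    exact hmul a ha b hb
  have h2 : ∀ x ∈ Submodule.span ℂ G, star x ∈ Submodule.span ℂ G := by
    intro x hx
    induction hx using Submodule.span_induction with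
    | mem x hx => exact Submodule.subset_span (hstar x hx)
    | zero => simp
    | add x y _ _ hx hy => simpa using add_mem hx hy
    | smul c x _ hx => simpa using Submodule.smul_mem _ _ hx
  exact ⟨{ (Submodule.span ℂ G).topologicalClosure with
    mul_mem' := fun {x y} hx hy => map_mem_closure₂ continuous_mul hx hy h1
    star_mem' := fun {x} hx => map_mem_closure continuous_star hx h2 }, rfl⟩

/-- A closed subspace of `B` that contains the products `(j_Γ(s)* j_A(a)) (j_Γ(t)* j_A(b))*` is
all of `B`. -/
theorem IsClosedSpan.eq_top {B : Type w} [NonUnitalCStarAlgebra B] {jA : A →⋆ₙₐ[ℂ] B}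
    {jΓ : PosCone Γ → 𝓜(ℂ, B)} (h : IsClosedSpan jA jΓ) {E : Submodule ℂ B}
    (hE : IsClosed (E : Set B)) (hmem : ∀ s t a b,
      (star (jΓ s)).fst (jA a) * star ((star (jΓ t)).fst (jA b)) ∈ E) : E = ⊤ := by
  have hcl : IsClosed ((fun b : B => (b : 𝓜(ℂ, B))) '' E) :=
    isometry_coe.isClosedEmbedding.isClosedMap _ hE
  let F : Submodule ℂ 𝓜(ℂ, B) := E.map
    ((DoubleCentralizer.coeHom (𝕜 := ℂ) (A := B) : B →⋆ₙₐ[ℂ] 𝓜(ℂ, B)) : B →ₗ[ℂ] 𝓜(ℂ, B))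
  have hle : Set.range (fun b : B => (b : 𝓜(ℂ, B))) ⊆ (fun b : B => (b : 𝓜(ℂ, B))) '' E := by
    rw [show Set.range (fun b : B => (b : 𝓜(ℂ, B))) = _ from h]
    refine closure_minimal ?_ hcl
    suffices Submodule.span ℂ _ ≤ F from this
    refine Submodule.span_le.2 ?_
    rintro _ ⟨s, t, a, rfl⟩
    obtain ⟨l, hl, hb⟩ := exists_bounded_approximateUnit A
    have := hl.neBot
    -- Replacing a by ae factors the spanning element as (j_Γ(s)*j_A(a))(j_Γ(t)*j_A(e*))*.
    have h1 : Tendsto (fun e => ((jA (a * e) : B) : 𝓜(ℂ, B))) l (𝓝 (jA a : 𝓜(ℂ, B))) :=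
      (isometry_coe.continuous.tendsto _).comp
        (((continuous_hom jA).tendsto _).comp (hl.tendsto_mul_left a))
    refine hcl.mem_of_tendsto ((h1.const_mul (star (jΓ s))).mul_const (jΓ t))
      (Eventually.of_forall fun e => ⟨_, hmem s t a (star e), ?_⟩)
    change (((star (jΓ s)).fst (jA a) * star ((star (jΓ t)).fst (jA (star e))) : B) :
      𝓜(ℂ, B)) = _
    rw [coe_mul, coe_star, ← mul_coe, ← mul_coe, star_mul, star_star, ← coe_star, ← map_star jA,
      star_star, map_mul jA, coe_mul]
    simp only [mul_assoc]
  refine eq_top_iff.2 fun b _ => ?_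
  obtain ⟨c, hc, hcb⟩ := hle ⟨b, rfl⟩
  exact coe_injective hcb ▸ hc

variable [IsOrderedAddMonoid Γ] {α : ExtendibleAction Γ A}

theorem IsCovariantIn.eq_zero {B : Type w} [NonUnitalCStarAlgebra B] {jA : A →⋆ₙₐ[ℂ] B}
    {jΓ : PosCone Γ → 𝓜(ℂ, B)} (h : IsCovariantIn α jA jΓ) (m : 𝓜(ℂ, B))
    (hm : ∀ a, m * ((DoubleCentralizer.coeHom (𝕜 := ℂ) (A := B)).comp jA) a = 0) : m = 0 :=
  multiplier_eq_zero h.1 m hm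

theorem isClosed_range_coe (B : Type w) [NonUnitalCStarAlgebra B] :
    IsClosed (Set.range (fun b : B => (b : 𝓜(ℂ, B)))) :=
  isometry_coe.isClosedEmbedding.isClosed_range

/-- The closed span is a *-subalgebra of M(B) containing every ψₛ(x), hence all of B. Conversely its
spanning elements lie in B, because B is an ideal of M(B). -/
theorem ToeplitzRep.isClosedSpan {B : Type w} [NonUnitalCStarAlgebra B] (ψ : ToeplitzRep α B)
    (hψ : ∀ S : NonUnitalStarSubalgebra ℂ B, IsClosed (S : Set B) →
      (∀ s x, ψ.map s x ∈ S) → S = ⊤) {V : PosCone Γ → 𝓜(ℂ, B)} (hV : IsCovariantIn α ψ.hom V)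
    (hc : ∀ s a, star (V s) * (ψ.hom a : 𝓜(ℂ, B)) = (ψ.ext s a : 𝓜(ℂ, B))) :
    IsClosedSpan ψ.hom V := by
  set G := {m : 𝓜(ℂ, B) | ∃ (s t : PosCone Γ) (a : A),
      m = star (V s) * (ψ.hom a : 𝓜(ℂ, B)) * V t} with hG
  obtain ⟨S, hS⟩ := exists_starSubalgebra_closure_span G
    (by
      rintro _ ⟨s, t, a, rfl⟩ _ ⟨r, q, b, rfl⟩
      exact hV.2.exists_mul_eq hV.eq_zero s t r q a b)
    (by
      rintro _ ⟨s, t, a, rfl⟩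
      refine ⟨t, s, star a, ?_⟩
      rw [star_mul, star_mul, star_star, map_star ψ.hom, coe_star, mul_assoc])
  change Set.range _ = closure (Submodule.span ℂ G : Set 𝓜(ℂ, B))
  refine Set.Subset.antisymm ?_ ?_
  · rintro _ ⟨b, rfl⟩
    have htop : S.comap (DoubleCentralizer.coeHom (𝕜 := ℂ) (A := B)) = ⊤ := by
      refine hψ _ ?_ fun s x => ?_
      · have hcl : IsClosed (S : Set 𝓜(ℂ, B)) := hS ▸ isClosed_closure
        exact hcl.preimage isometry_coe.continuous
      · change (ψ.map s x : 𝓜(ℂ, B)) ∈ (S : Set 𝓜(ℂ, B))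
        rw [hS]
        -- The index t = 0 suffices because ψ₀(x)V₀ = ψ₀(x).
        refine subset_closure (Submodule.subset_span ⟨s, 0, x, ?_⟩)
        rw [mul_assoc]
        have := hV.2.map_mul_zero x
        change (ψ.hom x : 𝓜(ℂ, B)) * V 0 = ψ.hom x at this
        rw [this, hc, ψ.ext_coe]
    rw [← hS]
    exact (htop ▸ trivial : b ∈ S.comap (DoubleCentralizer.coeHom (𝕜 := ℂ) (A := B)))
  · refine closure_minimal ?_ (isClosed_range_coe B)
    let R : Submodule ℂ 𝓜(ℂ, B) :=
      LinearMap.range ((DoubleCentralizer.coeHom (𝕜 := ℂ) (A := B) : B →⋆ₙₐ[ℂ] 𝓜(ℂ, B)) :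
        B →ₗ[ℂ] 𝓜(ℂ, B))
    have : Submodule.span ℂ G ≤ R := by
      refine Submodule.span_le.2 ?_
      rintro _ ⟨s, t, a, rfl⟩
      rw [mul_coe, coe_mul_multiplier]
      exact ⟨_, rfl⟩
    exact this

theorem IsCovariantPair.map {C : Type w} [CStarAlgebra C] {D : Type z} [CStarAlgebra D]
    {π : A →⋆ₙₐ[ℂ] C} {V : PosCone Γ → C} (h : IsCovariantPair α π V) (Φ : C →⋆ₐ[ℂ] D)
    {π' : A →⋆ₙₐ[ℂ] D} (hπ : ∀ a, Φ (π a) = π' a) :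
    IsCovariantPair α π' fun s => Φ (V s) where
  partial_isometry s := by rw [← map_star Φ, ← map_mul, ← map_mul, h.partial_isometry]
  map_add s t := by rw [← map_mul, h.map_add]
  conj s a := by rw [← hπ, ← hπ, h.conj, map_mul, map_mul, map_star Φ]
  comm s a := by rw [← hπ, ← map_star Φ, ← map_mul, ← map_mul, ← map_mul, h.comm]

end ClosedSpan

/-! ### The Fock representation on ℓ²(Γ⁺, K). -/

section Fock

variable {Γ : Type v} [AddCommGroup Γ] [LinearOrder Γ]
variable {K : Type w} [NormedAddCommGroup K] [InnerProductSpace ℂ K]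

theorem clm_ext_single {X Y : lp (fun _ : PosCone Γ => K) 2 →L[ℂ] lp (fun _ : PosCone Γ => K) 2}
    (h : ∀ s x, X (lp.single 2 s x) = Y (lp.single 2 s x)) : X = Y :=
  lp.ext_continuousLinearMap (by simp) fun s => ContinuousLinearMap.ext fun x => h s x

/-- The isometry of `K` onto a summand of `ℓ²(Γ⁺, K)`. -/
def singleIsometry (K : Type w) [NormedAddCommGroup K] [InnerProductSpace ℂ K]
    (s : PosCone Γ) : K →ₗᵢ[ℂ] lp (fun _ : PosCone Γ => K) 2 where
  toLinearMap := lp.lsingle (𝕜 := ℂ) (E := fun _ : PosCone Γ => K) 2 s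
  norm_map' x := lp.norm_single (E := fun _ : PosCone Γ => K) (p := 2) two_pos s x

variable [IsOrderedAddMonoid Γ]

theorem orthogonalFamily_single (t : PosCone Γ) :
    OrthogonalFamily ℂ (fun _ : PosCone Γ => K) fun s => singleIsometry K (s + t) := by
  intro i j hij x y
  change inner ℂ (lp.single (E := fun _ : PosCone Γ => K) 2 (i + t) x)
    (lp.single (E := fun _ : PosCone Γ => K) 2 (j + t) y) = 0
  have hne : i + t ≠ j + t := fun h => hij (Subtype.ext (add_right_cancel (congrArg Subtype.val h)))
  rw [lp.inner_single_left, lp.single_apply_ne _ _ _ hne, inner_zero_right]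

/-- The shift `ξ ↦ ξ(· - t)` on `ℓ²(Γ⁺, K)`. -/
def shift (K : Type w) [NormedAddCommGroup K] [InnerProductSpace ℂ K] [CompleteSpace K]
    (t : PosCone Γ) :
    lp (fun _ : PosCone Γ => K) 2 →L[ℂ] lp (fun _ : PosCone Γ => K) 2 :=
  (orthogonalFamily_single t).linearIsometry.toContinuousLinearMap

variable [CompleteSpace K]

theorem shift_single (s t : PosCone Γ) (x : K) :
    shift K t (lp.single 2 s x) = lp.single 2 (s + t) x :=
  (orthogonalFamily_single t).linearIsometry_apply_single x

theorem star_shift_mul_shift (t : PosCone Γ) : star (shift K t) * shift K t = 1 :=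
  LinearIsometry.adjoint_comp_self (𝕜 := ℂ) (orthogonalFamily_single (K := K) t).linearIsometry

variable {A : Type u} [NonUnitalCStarAlgebra A] (α : ExtendibleAction Γ A)

/-- The covariant pair on `ℓ²(Γ⁺, K)` induced by a representation of `A` on `K`. -/
theorem isCovariantPair_shift (σ : A →⋆ₙₐ[ℂ] (K →L[ℂ] K)) :
    IsCovariantPair α (directSumRep fun s : PosCone Γ => σ.comp (α.act s))
      fun s => star (shift K s) := by
  set D := directSumRep fun s : PosCone Γ => σ.comp (α.act s) with hD
  -- On the summand r both sides act by σ(αᵣ₊ₛ(a)) = σ(αᵣ(αₛ(a))). The remaining relations follow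
  -- from this one and Sₛ*Sₛ = 1.
  have hcomm : ∀ s a, D a * shift K s = shift K s * D (α.act s a) := fun s a =>
    clm_ext_single fun r x => by
      change D a (shift K s (lp.single 2 r x)) = shift K s (D (α.act s a) (lp.single 2 r x))
      rw [shift_single, hD, directSumRep_single, directSumRep_single, shift_single]
      simp [α.act_add]
  have hcomm' : ∀ s a, star (shift K s) * D a = D (α.act s a) * star (shift K s) := fun s a => by
    have := congrArg star (hcomm s (star a))
    rwa [star_mul, star_mul, ← map_star D, ← map_star D, ← map_star (α.act s), star_star] at this
  refine ⟨fun s => ?_, fun s t => ?_, fun s a => ?_, fun s a => ?_⟩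
  · rw [star_star, star_shift_mul_shift, one_mul]
  · rw [← star_mul]
    refine congrArg star (clm_ext_single fun r x => ?_)
    change shift K t (shift K s (lp.single 2 r x)) = _
    rw [shift_single, shift_single, shift_single, add_assoc]
  · rw [star_star, mul_assoc, hcomm, ← mul_assoc, star_shift_mul_shift, one_mul]
  · rw [star_star, mul_assoc, hcomm', ← mul_assoc, ← hcomm, mul_assoc]

end Fock

/-! ### Extending and factoring homomorphisms. -/

section Factorization

variable {Γ : Type v} [AddCommGroup Γ] [LinearOrder Γ] {A : Type u} [NonUnitalCStarAlgebra A]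

theorem IsClosedSpan.extension_mem {B : Type z} [NonUnitalCStarAlgebra B]
    {D : Type w} [CStarAlgebra D] {jA : A →⋆ₙₐ[ℂ] B} {jΓ : PosCone Γ → 𝓜(ℂ, B)}
    (hspan : IsClosedSpan jA jΓ) (ρbar : 𝓜(ℂ, B) →⋆ₐ[ℂ] D) {R : Submodule ℂ D}
    (hR : IsClosed (R : Set D))
    (h : ∀ s t a, ρbar (star (jΓ s) * (jA a : 𝓜(ℂ, B)) * jΓ t) ∈ R) (b : B) :
    ρbar (b : 𝓜(ℂ, B)) ∈ R := by
  have hcont : Continuous ρbar := continuous_hom (ρbar : 𝓜(ℂ, B) →⋆ₙₐ[ℂ] D)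
  have hb : (b : 𝓜(ℂ, B)) ∈ Set.range (fun b : B => (b : 𝓜(ℂ, B))) := ⟨b, rfl⟩
  rw [show Set.range (fun b : B => (b : 𝓜(ℂ, B))) = _ from hspan] at hb
  have hle : Submodule.span ℂ {m : 𝓜(ℂ, B) | ∃ (s t : PosCone Γ) (a : A),
      m = star (jΓ s) * (jA a : 𝓜(ℂ, B)) * jΓ t} ≤ R.comap (ρbar : 𝓜(ℂ, B) →ₗ[ℂ] D) := by
    refine Submodule.span_le.2 ?_
    rintro _ ⟨s, t, a, rfl⟩
    exact h s t a
  exact closure_minimal (fun x hx => hle hx) (hR.preimage hcont) hb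

/-- A homomorphism that takes its values in the range of an injective one factors through it. -/
theorem exists_factorization {B : Type z} [NonUnitalCStarAlgebra B] {T : Type u}
    [NonUnitalCStarAlgebra T] {D : Type w} [NonUnitalCStarAlgebra D] (ρ : B →⋆ₙₐ[ℂ] D)
    {σ : T →⋆ₙₐ[ℂ] D} (hσ : Function.Injective σ) (h : ∀ b, ∃ t, σ t = ρ b) :
    ∃ φ : B →⋆ₙₐ[ℂ] T, ∀ b, σ (φ b) = ρ b := by
  choose g hg using h
  exact ⟨{ toFun := g
           map_smul' := fun c b => hσ (by
            rw [hg, MonoidHom.id_apply, map_smul, map_smul, hg])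
           map_zero' := hσ (by rw [hg, map_zero, map_zero])
           map_add' := fun b c => hσ (by rw [hg, map_add, map_add, hg, hg])
           map_mul' := fun b c => hσ (by rw [hg, map_mul, map_mul, hg, hg])
           map_star' := fun b => hσ (by rw [hg, map_star ρ, map_star σ, hg]) }, hg⟩

end Factorization

/-! ### Injectivity, lifting and uniqueness. -/

section Main

variable {Γ : Type v} [AddCommGroup Γ] [LinearOrder Γ] [IsOrderedAddMonoid Γ]
variable {A : Type u} [NonUnitalCStarAlgebra A] {α : ExtendibleAction Γ A}

/-- The homomorphism of `𝒯_X` induced by a covariant pair. -/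
theorem IsCovariantPair.exists_hom {C : Type w} [CStarAlgebra C] {π : A →⋆ₙₐ[ℂ] C}
    {V : PosCone Γ → C} (h : IsCovariantPair α π V) : ∃ ρ : ToeplitzAlgebra α →⋆ₙₐ[ℂ] C,
      (∀ s (x : Fiber α s), ρ ((iX α).map s x) = star (V s) * π x) ∧
      ∀ a, ρ ((iX α).hom a) = π a := by
  obtain ⟨ρ, hρ, -⟩ := toeplitz_universal α (h.toeplitzRep (NonUnitalStarAlgHom.id ℂ C)
    Function.injective_id (fun s => LinearMap.mulLeft ℂ (star (V s)) ∘ₗ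
      (π : A →ₗ[ℂ] C)) π (fun _ => rfl) fun _ _ => rfl)
  refine ⟨ρ, hρ, fun a => ?_⟩
  rw [(iX α).hom_eq, hρ, ← ToeplitzRep.hom_eq]
  rfl

/-- The Fock representation of A factors through i_A, and it is faithful because its summand at
index 0 is σ. -/
theorem iX_hom_injective (α : ExtendibleAction Γ A) : Function.Injective (iX α).hom := by
  obtain ⟨K, _, _, _, σ, hσ, -⟩ := exists_faithful_rep A
  have h := isCovariantPair_shift α σ
  set D := directSumRep fun s : PosCone Γ => σ.comp (α.act s)
  have hD : Function.Injective D := directSumRep_injective _ fun a ha => ⟨0, fun h0 => ha (hσ (by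
    rw [map_zero, ← h0, NonUnitalStarAlgHom.comp_apply, α.act_zero]))⟩
  obtain ⟨φ, -, hφ⟩ := h.exists_hom
  exact Function.Injective.of_comp (f := φ) fun a b hab => hD (by simpa [hφ] using hab)

/-- The Toeplitz algebra has the lifting property of the partial-isometric crossed product. -/
theorem liftsCovariantReps_toeplitz {V : PosCone Γ → 𝓜(ℂ, ToeplitzAlgebra α)}
    (hc : ∀ s a, star (V s) * ((iX α).hom a : 𝓜(ℂ, ToeplitzAlgebra α)) =
      ((iX α).ext s a : 𝓜(ℂ, ToeplitzAlgebra α))) :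
    LiftsCovariantReps.{u, v, w} α (iX α).hom V := by
  intro H _ _ _ π U hπ
  obtain ⟨hnd, h⟩ := hπ
  obtain ⟨ρ, hρ', hρA⟩ := h.exists_hom
  have hcomp : ρ.comp (iX α).hom = π := by
    ext a : 1
    exact hρA a
  have hρnd : IsNondegenerate ρ := IsNondegenerate.of_comp (f := (iX α).hom) (hcomp.symm ▸ hnd)
  obtain ⟨ρbar, hbar⟩ := hρnd.exists_extension
  refine ⟨ρ, hρnd, hρA, ρbar, hbar, fun s => star_injective (hnd.ext fun a => ?_)⟩
  have hN : ∀ m : H →L[ℂ] H, (∀ a, m * π a = 0) → m = 0 := fun m hm =>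
    hnd.ext fun a => by rw [hm, zero_mul]
  -- Both adjoints agree on π(A)H: the extension of ρ sends Vₛ*i_A(a) to Uₛ*π(ᾱₛ(1)a), which equals
  -- Uₛ*π(a).
  obtain ⟨x, hx⟩ := ToeplitzRep.exists_fiber (α := α) s a
  rw [← map_star ρbar, ← hρA, ← hbar, ← map_mul, hc, hbar, (iX α).ext_eq x hx, hρ', hx,
    h.star_mul_map_barOne hN, hbar, hρA]

/-- Uniqueness of the partial-isometric crossed product. -/
theorem exists_equiv_toeplitz {V : PosCone Γ → 𝓜(ℂ, ToeplitzAlgebra α)}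
    (hV : IsCovariantIn α (iX α).hom V)
    (hc : ∀ s a, star (V s) * ((iX α).hom a : 𝓜(ℂ, ToeplitzAlgebra α)) =
      ((iX α).ext s a : 𝓜(ℂ, ToeplitzAlgebra α)))
    {B : Type z} [NonUnitalCStarAlgebra B] {jA : A →⋆ₙₐ[ℂ] B} {jΓ : PosCone Γ → 𝓜(ℂ, B)}
    (hj : IsCovariantIn α jA jΓ) (hlift : LiftsCovariantReps.{u, v, max u v} α jA jΓ)
    (hspan : IsClosedSpan jA jΓ) :
    ∃ φ : B ≃⋆ₐ[ℂ] ToeplitzAlgebra α, (∀ a, φ (jA a) = (iX α).hom a) ∧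
      ∃ φbar : 𝓜(ℂ, B) →⋆ₐ[ℂ] 𝓜(ℂ, ToeplitzAlgebra α),
        (∀ b : B, φbar (b : 𝓜(ℂ, B)) =
          ((φ b : ToeplitzAlgebra α) : 𝓜(ℂ, ToeplitzAlgebra α))) ∧
        ∀ s, φbar (jΓ s) = V s := by
  -- This Hilbert space lies in the universe of 𝒯_X, which is where the lifting property of B is
  -- assumed.
  obtain ⟨H, _, _, _, σ, hσ, hσnd⟩ := exists_faithful_rep (ToeplitzAlgebra α)
  obtain ⟨σbar, hσbar⟩ := hσnd.exists_extension
  obtain ⟨ρ, -, hρA, ρbar, hρbar, hρV⟩ := hlift H (σ.comp (iX α).hom) (fun s => σbar (V s))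
    ⟨hσnd.comp hV.1, hV.2.map σbar fun a => hσbar _⟩
  replace hρA : ∀ a, ρ (jA a) = σ ((iX α).hom a) := hρA
  let R : Submodule ℂ (H →L[ℂ] H) := LinearMap.range (σ : ToeplitzAlgebra α →ₗ[ℂ] (H →L[ℂ] H))
  have hrange : ∀ b, ∃ t, σ t = ρ b := fun b => by
    rw [← hρbar]
    refine hspan.extension_mem ρbar
      (R := R)
      (NonUnitalStarAlgHom.isometry σ hσ).isClosedEmbedding.isClosed_range (fun s t a => ?_) b
    rw [map_mul, map_mul, map_star ρbar, hρV, hρV, hρbar, hρA, ← hσbar, ← map_star σbar,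
      ← map_mul, ← map_mul, mul_coe, coe_mul_multiplier, hσbar]
    exact ⟨_, rfl⟩
  obtain ⟨φ, hφ⟩ := exists_factorization ρ hσ hrange
  have hφA : ∀ a, φ (jA a) = (iX α).hom a := fun a => hσ (by rw [hφ, hρA])
  have hφmul : ∀ (s : PosCone Γ) b, φ ((jΓ s).fst b) = (V s).fst (φ b) := fun s b => hσ (by
    rw [hφ, ← hρbar, ← mul_coe, map_mul, hρV, hρbar, ← hφ, ← hσbar, ← map_mul, mul_coe, hσbar])
  have hφstar : ∀ s a, φ ((star (jΓ s)).fst (jA a)) = (iX α).ext s a := fun s a => hσ (by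
    rw [hφ, ← hρbar, ← mul_coe, map_mul, map_star ρbar, hρV, hρbar, hρA, ← hσbar,
      ← map_star σbar, ← map_mul, hc, hσbar])
  let f : PosCone Γ → A →ₗ[ℂ] B := fun s =>
    ((star (jΓ s)).fst : B →ₗ[ℂ] B) ∘ₗ (jA : A →ₗ[ℂ] B)
  have hf : ∀ s a, f s a = (star (jΓ s)).fst (jA a) := fun s a => rfl
  have hfbar : ∀ s a, f s ((barOne α s).fst a) = f s a := fun s a => coe_injective (by
    have := hj.2.star_mul_map_barOne hj.eq_zero s a
    change ((_ : B) : 𝓜(ℂ, B)) = ((_ : B) : 𝓜(ℂ, B))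
    rw [hf, hf, ← mul_coe, ← mul_coe]
    exact this)
  obtain ⟨φ', hφ', -⟩ := toeplitz_universal α (hj.2.toeplitzRep
    (DoubleCentralizer.coeHom (𝕜 := ℂ) (A := B)) coe_injective f jA (fun _ => rfl)
    (fun s a => (mul_coe (star (jΓ s)) (jA a)).symm))
  replace hφ' : ∀ s (x : Fiber α s), φ' ((iX α).map s x) = f s x := hφ'
  have hφ'ext : ∀ s a, φ' ((iX α).ext s a) = f s a := fun s a => by
    obtain ⟨x, hx⟩ := ToeplitzRep.exists_fiber (α := α) s a
    rw [(iX α).ext_eq x hx, hφ', hx, hfbar]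
  -- The equalizer of φ' ∘ φ and the identity is closed and contains the products
  -- (j_Γ(s)*j_A(a))(j_Γ(t)*j_A(c))*, which span a dense subspace of B.
  have hleft : ∀ b, φ' (φ b) = b := fun b => by
    have htop := hspan.eq_top (E := LinearMap.eqLocus ((φ'.comp φ : B →⋆ₙₐ[ℂ] B) : B →ₗ[ℂ] B)
      LinearMap.id) (isClosed_eq (continuous_hom (φ'.comp φ)) continuous_id) fun s t a c => by
        change φ' (φ _) = _
        rw [map_mul, map_star φ, hφstar, hφstar, map_mul, map_star φ', hφ'ext, hφ'ext]
        rfl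
    exact (htop ▸ Submodule.mem_top : b ∈ LinearMap.eqLocus
      ((φ'.comp φ : B →⋆ₙₐ[ℂ] B) : B →ₗ[ℂ] B) LinearMap.id)
  have hright : ∀ t, φ (φ' t) = t := fun t => by
    have := (toeplitz_universal α (iX α)).unique (y₁ := φ.comp φ')
      (y₂ := NonUnitalStarAlgHom.id ℂ _)
      (fun s x => by
        change φ (φ' _) = _
        rw [hφ', hf, hφstar, ToeplitzRep.ext_coe]) fun s x => rfl
    exact congrArg (fun g : ToeplitzAlgebra α →⋆ₙₐ[ℂ] ToeplitzAlgebra α => g t) this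
  let e : B ≃⋆ₐ[ℂ] ToeplitzAlgebra α := StarAlgEquiv.ofBijective φ
    ⟨Function.LeftInverse.injective hleft, Function.RightInverse.surjective hright⟩
  obtain ⟨φbar, hφbar, hφbarmul⟩ := exists_multiplierMap e
  refine ⟨e, hφA, φbar, hφbar, fun s => multiplier_ext fun t => ?_⟩
  rw [← hright t]
  exact (hφbarmul (jΓ s) (φ' t)).trans (hφmul s (φ' t))

end Main
end PartialIsometric
end
open PartialIsometric in
theorem proposition4p7 {Γ : Type v} [AddCommGroup Γ] [LinearOrder Γ] [IsOrderedAddMonoid Γ]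
    {A : Type u} [NonUnitalCStarAlgebra A] (α : ExtendibleAction Γ A) :
    ∃ (iA : A →⋆ₙₐ[ℂ] ToeplitzAlgebra α) (iΓ : PosCone Γ → 𝓜(ℂ, ToeplitzAlgebra α)),
      IsCovariantIn α iA iΓ ∧ Function.Injective iA ∧
      LiftsCovariantReps.{u, v, w} α iA iΓ ∧ IsClosedSpan iA iΓ ∧
      ∀ (B : Type z) [NonUnitalCStarAlgebra B] (jA : A →⋆ₙₐ[ℂ] B) (jΓ : PosCone Γ → 𝓜(ℂ, B)),
        IsCovariantIn α jA jΓ → LiftsCovariantReps.{u, v, max u v} α jA jΓ →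
        IsClosedSpan jA jΓ →
        ∃ φ : B ≃⋆ₐ[ℂ] ToeplitzAlgebra α, (∀ a, φ (jA a) = iA a) ∧
          ∃ φbar : 𝓜(ℂ, B) →⋆ₐ[ℂ] 𝓜(ℂ, ToeplitzAlgebra α),
            (∀ b : B, φbar (b : 𝓜(ℂ, B)) = ((φ b : ToeplitzAlgebra α) : 𝓜(ℂ, ToeplitzAlgebra α))) ∧
            ∀ s, φbar (jΓ s) = iΓ s := by
  have hgen := toeplitz_generated α
  obtain ⟨V, hV, hc⟩ := (iX α).exists_isCovariantIn hgen
  exact ⟨(iX α).hom, V, hV, iX_hom_injective α, liftsCovariantReps_toeplitz hc,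
    (iX α).isClosedSpan hgen hV hc,
    fun B _ jA jΓ hj hlift hspan => exists_equiv_toeplitz hV hc hj hlift hspan⟩
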